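/- Let $\Lambda$ be an artin algebra, i.e. a ring whose center $Z(\Lambda)$ is an artinian ring and which is finitely generated as a module over $Z(\Lambda)$. Let $\Lambda\text{-proj}$ be the category of finitely generated projective left $\Lambda$-modules, and let $$\mathbf{D}_{\rm sg}(\Lambda)=\mathbf{K}^{-,b}(\Lambda\text{-proj})/\mathbf{K}^{b}(\Lambda\text{-proj})$$ be the singularity category of $\Lambda$, that is, the Verdier quotient of the homotopy category of bounded-above complexes in $\Lambda\text{-proj}$ with bounded cohomology by the homotopy category of bounded complexes in $\Lambda\text{-proj}$; denote its suspension functor by $\Sigma$. An object $X$ of a triangulated category $\mathcal{T}$ with suspension $\Sigma$ is called presilting if ${\rm Hom}_{\mathcal{T}}(X,\Sigma^n(X))=0$ for all $n>0$. Consider the following two assertions about $\Lambda$. (SPC) The Singular Presilting Conjecture holds for $\Lambda$: there is no nonzero presilting object in $\mathbf{D}_{\rm sg}(\Lambda)$. (ARC) The Auslander–Reiten Conjecture holds for $\Lambda$: for every finitely generated non-projective left $\Lambda$-module $M$ there is an $n\geq 1$ with ${\rm Ext}^n_\Lambda(M,M\oplus\Lambda)\neq 0$. Then (SPC) implies (ARC).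 If moreover $\Lambda$ is Gorenstein, i.e. $\Lambda$ is two-sided noetherian and the injective dimensions of $\Lambda$ as a left and as a right module over itself are finite, then (ARC) implies (SPC). -/

import Mathlib

open CategoryTheory CategoryTheory.Limits CategoryTheory.Pretriangulated
open scoped ZeroObject

universe u v

namespace SingularityCategory

/-! ### Bounded and bounded-above complexes up to homotopy -/

section Boundedness

variable (C : Type u) [Category.{v} C] [Preadditive C]

/-- The objects of `K(C)` whose underlying cochain complex is bounded above; the corresponding
full subcategory is `K⁻(C)`. -/
def minus : ObjectProperty (HomotopyCategory C (.up ℤ)) :=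
  fun X => ∃ n : ℤ, CochainComplex.IsStrictlyLE X.as n

/-- The objects of `K(C)` whose underlying cochain complex is bounded; the corresponding full
subcategory is `Kᵇ(C)`. -/
def bounded : ObjectProperty (HomotopyCategory C (.up ℤ)) :=
  fun X => (∃ n : ℤ, CochainComplex.IsStrictlyGE X.as n) ∧
    (∃ n : ℤ, CochainComplex.IsStrictlyLE X.as n)

variable {C}

lemma isStrictlyLE_mappingCone [HasBinaryBiproducts C] {K L : CochainComplex C ℤ} (f : K ⟶ L)
    (n₁ n₂ n : ℤ) [K.IsStrictlyLE n₁] [L.IsStrictlyLE n₂] (hn₁ : n₁ - 1 ≤ n) (hn₂ : n₂ ≤ n) :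
    (CochainComplex.mappingCone f).IsStrictlyLE n := by
  rw [CochainComplex.isStrictlyLE_iff]
  intro i hi
  simp only [CochainComplex.mappingCone.isZero_X_iff]
  exact ⟨K.isZero_of_isStrictlyLE n₁ _ (by lia), L.isZero_of_isStrictlyLE n₂ _ (by lia)⟩

/-- The third vertex of a distinguished triangle on `X ⟶ Y` is isomorphic to the mapping cone of
a morphism between the underlying complexes. -/
lemma exists_iso_mappingCone [HasZeroObject C] [HasBinaryBiproducts C]
    (T : Triangle (HomotopyCategory C (.up ℤ))) (hT : T ∈ distTriang _) :
    ∃ f : (T.obj₁.as : CochainComplex C ℤ) ⟶ T.obj₂.as, Nonempty (T.obj₃ ≅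
      (HomotopyCategory.quotient C (.up ℤ)).obj (CochainComplex.mappingCone f)) := by
  obtain ⟨f : T.obj₁.as ⟶ T.obj₂.as, hf⟩ :=
    (HomotopyCategory.quotient C (.up ℤ)).map_surjective T.mor₁
  refine ⟨f, ⟨Triangle.π₃.mapIso (isoTriangleOfIso₁₂ T _ hT
    (HomotopyCategory.mappingCone_triangleh_distinguished f) (Iso.refl _) (Iso.refl _) ?_)⟩⟩
  exact (Category.comp_id _).trans (hf.symm.trans (Category.id_comp _).symm)

instance [HasZeroObject C] : (minus C).ContainsZero where
  exists_zero := ⟨(HomotopyCategory.quotient _ _).obj 0,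
    Functor.map_isZero _ (isZero_zero _), 0, inferInstanceAs
      (CochainComplex.IsStrictlyLE (0 : CochainComplex C ℤ) 0)⟩

instance [HasZeroObject C] : (bounded C).ContainsZero where
  exists_zero := ⟨(HomotopyCategory.quotient _ _).obj 0,
    Functor.map_isZero _ (isZero_zero _), ⟨0, inferInstanceAs
      (CochainComplex.IsStrictlyGE (0 : CochainComplex C ℤ) 0)⟩, 0, inferInstanceAs
      (CochainComplex.IsStrictlyLE (0 : CochainComplex C ℤ) 0)⟩

instance : (minus C).IsStableUnderShift ℤ where
  isStableUnderShiftBy a :=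
    { le_shift := by
        intro X hX
        obtain ⟨K : CochainComplex _ _, rfl⟩ := X.quotient_obj_surjective
        obtain ⟨n, hn⟩ : ∃ n : ℤ, K.IsStrictlyLE n := hX
        rw [ObjectProperty.prop_shift_iff, HomotopyCategory.shift_quotient_obj]
        exact ⟨n - a, K.isStrictlyLE_shift n a (n - a) (by lia)⟩ }

instance : (bounded C).IsStableUnderShift ℤ where
  isStableUnderShiftBy a :=
    { le_shift := by
        intro X hX
        obtain ⟨K : CochainComplex _ _, rfl⟩ := X.quotient_obj_surjective
        obtain ⟨⟨m, hm⟩, n, hn⟩ : (∃ m : ℤ, K.IsStrictlyGE m) ∧ ∃ n : ℤ, K.IsStrictlyLE n := hX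
        rw [ObjectProperty.prop_shift_iff, HomotopyCategory.shift_quotient_obj]
        exact ⟨⟨m - a, K.isStrictlyGE_shift m a (m - a) (by lia)⟩,
          n - a, K.isStrictlyLE_shift n a (n - a) (by lia)⟩ }

instance [HasZeroObject C] [HasBinaryBiproducts C] : (minus C).IsTriangulatedClosed₃ where
  ext₃' T hT := by
    rintro ⟨n₁, h₁⟩ ⟨n₂, h₂⟩
    obtain ⟨f, ⟨e⟩⟩ := exists_iso_mappingCone T hT
    exact ⟨_, ⟨max (n₁ - 1) n₂, isStrictlyLE_mappingCone f n₁ n₂ _ (by simp) (by simp)⟩, ⟨e⟩⟩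

instance [HasZeroObject C] [HasBinaryBiproducts C] : (bounded C).IsTriangulatedClosed₃ where
  ext₃' T hT := by
    rintro ⟨⟨m₁, h₁⟩, n₁, h₁'⟩ ⟨⟨m₂, h₂⟩, n₂, h₂'⟩
    obtain ⟨f, ⟨e⟩⟩ := exists_iso_mappingCone T hT
    exact ⟨_, ⟨⟨min (m₁ - 1) m₂, CochainComplex.isStrictlyGE_mappingCone f m₁ m₂ _
      (by lia) (by lia)⟩, max (n₁ - 1) n₂,
        isStrictlyLE_mappingCone f n₁ n₂ _ (by simp) (by simp)⟩, ⟨e⟩⟩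

instance [HasZeroObject C] [HasBinaryBiproducts C] : (minus C).IsTriangulated where
  toIsTriangulatedClosed₂ := .of_isTriangulatedClosed₃

instance [HasZeroObject C] [HasBinaryBiproducts C] : (bounded C).IsTriangulated where
  toIsTriangulatedClosed₂ := .of_isTriangulatedClosed₃

end Boundedness

/-! ### Complexes with bounded cohomology -/

section BoundedCohomology

variable (A : Type u) [Category.{v} A] [Abelian A]

/-- The objects `X` of `K(A)` such that `Hⁱ(X) = 0` for all but finitely many `i`. -/
def boundedCohomology : ObjectProperty (HomotopyCategory A (.up ℤ)) :=
  fun X => ∃ N : ℤ, ∀ i : ℤ, N < |i| →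
    IsZero ((HomotopyCategory.homologyFunctor A (.up ℤ) i).obj X)

instance : (boundedCohomology A).IsClosedUnderIsomorphisms where
  of_iso := by
    rintro X Y e ⟨N, hN⟩
    exact ⟨N, fun i hi => (hN i hi).of_iso
      ((HomotopyCategory.homologyFunctor A (.up ℤ) i).mapIso e.symm)⟩

instance : (boundedCohomology A).IsTriangulated where
  exists_zero := ⟨0, isZero_zero _, 0, fun i _ => Functor.map_isZero _ (isZero_zero _)⟩
  isStableUnderShiftBy a :=
    { le_shift := by
        rintro X ⟨N, hN⟩
        refine ⟨N + |a|, fun i hi => (hN (a + i) ?_).of_iso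
          (((HomotopyCategory.homologyFunctor A (.up ℤ) 0).shiftIso a i (a + i) rfl).app X)⟩
        have := abs_sub_abs_le_abs_sub i (-a)
        rw [abs_neg, sub_neg_eq_add, add_comm i a] at this
        lia }
  ext₂' T hT := by
    rintro ⟨N₁, h₁⟩ ⟨N₃, h₃⟩
    refine ObjectProperty.le_isoClosure _ _ ⟨max N₁ N₃, fun i hi => ?_⟩
    exact ((HomotopyCategory.homologyFunctor A (.up ℤ) 0).homologySequence_exact₂
      T hT i).isZero_of_both_zeros
      ((h₁ i (lt_of_le_of_lt (le_max_left _ _) hi)).eq_of_src _ _)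
      ((h₃ i (lt_of_le_of_lt (le_max_right _ _) hi)).eq_of_tgt _ _)

end BoundedCohomology

/-! ### Finitely generated projective modules -/

section Modules

variable (R : Type u) [Ring R]

/-- The finitely generated projective left `R`-modules. -/
def fgProj : ObjectProperty (ModuleCat.{u} R) :=
  fun M => Module.Finite R M ∧ Module.Projective R M

instance : (fgProj R).IsClosedUnderIsomorphisms where
  of_iso := by
    rintro M N e ⟨_, _⟩
    exact ⟨Module.Finite.equiv e.toLinearEquiv, Module.Projective.of_equiv e.toLinearEquiv⟩

instance : (fgProj R).ContainsZero where
  exists_zero := ⟨ModuleCat.of R PUnit, ModuleCat.isZero_of_subsingleton _,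
    inferInstanceAs (Module.Finite R PUnit.{u + 1}), inferInstanceAs (Module.Projective R PUnit.{u + 1})⟩

instance : (fgProj R).IsClosedUnderBinaryProducts where
  limitsOfShape_le := by
    rintro M ⟨p⟩
    obtain ⟨_, _⟩ := p.prop_diag_obj ⟨.left⟩
    obtain ⟨_, _⟩ := p.prop_diag_obj ⟨.right⟩
    refine (fgProj R).prop_of_iso ((IsLimit.conePointsIsoOfNatIso
      (ModuleCat.binaryProductLimitCone (p.diag.obj ⟨.left⟩) (p.diag.obj ⟨.right⟩)).isLimit
      p.isLimit (diagramIsoPair p.diag).symm)) ?_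
    exact ⟨inferInstanceAs (Module.Finite R (p.diag.obj ⟨.left⟩ × p.diag.obj ⟨.right⟩)),
      inferInstanceAs (Module.Projective R (p.diag.obj ⟨.left⟩ × p.diag.obj ⟨.right⟩))⟩

instance : (fgProj R).IsClosedUnderFiniteProducts := .mk'

/-- The additive category `R-proj` of finitely generated projective left `R`-modules. -/
abbrev Proj := (fgProj R).FullSubcategory

instance : HasBinaryBiproducts (Proj R) := HasBinaryBiproducts.of_hasBinaryProducts

/-- The triangulated subcategory `K^{-,b}(R-proj)` of `K(R-proj)`: the complexes of finitely
generated projective left `R`-modules which are bounded above and have bounded cohomology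
(computed in the category of all left `R`-modules). -/
def minusBounded : ObjectProperty (HomotopyCategory (Proj R) (.up ℤ)) :=
  minus (Proj R) ⊓
    (boundedCohomology (ModuleCat.{u} R)).inverseImage ((fgProj R).ι.mapHomotopyCategory (.up ℤ))

instance : (minusBounded R).IsTriangulated :=
  inferInstanceAs (minus (Proj R) ⊓ (boundedCohomology (ModuleCat.{u} R)).inverseImage
    ((fgProj R).ι.mapHomotopyCategory (.up ℤ))).IsTriangulated

/-- The triangulated category `K^{-,b}(R-proj)`. -/
abbrev KMinusBounded := (minusBounded R).FullSubcategory

/-- `K^b(R-proj)` as a full triangulated subcategory of `K^{-,b}(R-proj)`: the complexes that are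
homotopy equivalent to a bounded complex of finitely generated projective left `R`-modules. -/
def perfect : ObjectProperty (KMinusBounded R) :=
  (bounded (Proj R)).isoClosure.inverseImage (minusBounded R).ι

instance : (perfect R).IsTriangulated :=
  inferInstanceAs ((bounded (Proj R)).isoClosure.inverseImage (minusBounded R).ι).IsTriangulated

/-- The singularity category `D_sg(R) = K^{-,b}(R-proj) / K^b(R-proj)`: the Verdier quotient, i.e.
the localization of `K^{-,b}(R-proj)` at the morphisms whose cone lies in `K^b(R-proj)`. -/
abbrev Dsg := (perfect R).trW.Localization

end Modules

end SingularityCategory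

/-- An object `M` of a triangulated category is presilting if `Hom(M, Σⁿ M) = 0` for all
`n > 0`. -/
def IsPresilting {T : Type u} [Category.{v} T] [HasZeroObject T] [Preadditive T] [HasShift T ℤ]
    [∀ n : ℤ, (shiftFunctor T n).Additive] [Pretriangulated T] (M : T) : Prop :=
  ∀ n : ℤ, 0 < n → ∀ f : M ⟶ M⟦n⟧, f = 0

/-- `Λ` is an artin algebra: its center is an artinian ring and `Λ` is a finitely generated module
over its center. -/
structure IsArtinAlgebra (Λ : Type u) [Ring Λ] : Prop where
  isArtinianRing_center : IsArtinianRing (Subring.center Λ)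
  finite_center : Module.Finite (Subring.center Λ) Λ

/-- `S` is a Gorenstein ring: it is two-sided noetherian and its injective dimension as a left
module and as a right module (a left module over the opposite ring) is at most `d`, for some
natural number `d`. -/
structure IsGorenstein (S : Type u) [Ring S] : Prop where
  isNoetherianRing : IsNoetherianRing S
  isNoetherianRing_op : IsNoetherianRing Sᵐᵒᵖ
  exists_injectiveDimension_le : ∃ d : ℕ,
    HasInjectiveDimensionLE (ModuleCat.of S S) d ∧ HasInjectiveDimensionLE (ModuleCat.of Sᵐᵒᵖ S) d

/-- The Singular Presilting Conjecture for `Λ`: there is no nonzero presilting object in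
`D_sg(Λ)`. -/
def SingularPresiltingConjecture (Λ : Type u) [Ring Λ] : Prop :=
  ¬ ∃ X : SingularityCategory.Dsg Λ, IsPresilting X ∧ ¬ IsZero X

/-- The Auslander-Reiten Conjecture for `Λ`: for each finitely generated non-projective left
`Λ`-module `M`, there is `n ≥ 1` with `Extⁿ(M, M ⊕ Λ) ≠ 0`. -/
def AuslanderReitenConjecture (Λ : Type u) [Ring Λ] : Prop :=
  ∀ (M : Type u) [AddCommGroup M] [Module Λ M], Module.Finite Λ M → ¬ Module.Projective Λ M →
    ∃ n : ℕ, 1 ≤ n ∧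
      Nontrivial (Abelian.Ext.{u} (ModuleCat.of Λ M) (ModuleCat.of Λ (M × Λ)) n)

/-! The bridge between the two conjectures is a module `M` with `Ext^n(M, Λ) = 0` for all `n ≥ 1`,
seen through a resolution `P` by finitely generated projectives placed in degrees `≤ 0`. The
vanishing says that cocycles on `P` in negative degrees with values in projectives extend along the
differential. Hence a map from `P` to a bounded complex is homotopic to one that vanishes in
negative degrees, so it factors through a perfect complex in degrees `≥ 0`
(`exists_factorization_perfect`). Such a complex has no nonzero map to `P⟦n⟧` for `n > 0`. Calculus
of fractions then identifies the maps `P ⟶ P⟦n⟧` in the singularity category with those in the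
homotopy category (`isPresilting_trW_Q_obj_iff`), that is, with `Ext^n(M, M)`. The same
factorization, applied to the identity, shows that `M` is projective if `P` becomes zero
(`projective_of_isZero_trW_Q_obj`).

A counterexample to (ARC) is therefore resolved by a nonzero presilting object. Conversely, suppose
that `Λ` has injective dimension at most `d`. A presilting object can be shifted so that it is given
by a complex exact in degrees `< d`. Cutting it brutally at degree `0` does not change it in the
singularity category and yields a resolution of a module `M`. This `M` is a `d`-th syzygy, so
`Ext^n(M, Λ)` is an `Ext^(n+d)` into `Λ` and vanishes (`exists_module_of_isPresilting`). By the
bridge `M` has no self-extensions; (ARC) makes it projective, and the object is zero. -/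

/-! ### Brutal truncations of cochain complexes -/

namespace CochainComplex

section BrutalTruncation

variable {C : Type u} [Category.{v} C] [Preadditive C] [HasZeroObject C]
  (K : CochainComplex C ℤ) (p : ℤ → Prop) [DecidablePred p]

/-- The terms of the brutal truncation of `K` to the degrees which satisfy `p`. -/
noncomputable def brutalX (i : ℤ) : C := if p i then K.X i else 0

/-- The inclusion of a term of the brutal truncation. -/
noncomputable def brutalι (i : ℤ) : K.brutalX p i ⟶ K.X i :=
  if h : p i then eqToHom (if_pos h) else 0

/-- The projection to a term of the brutal truncation. -/
noncomputable def brutalπ (i : ℤ) : K.X i ⟶ K.brutalX p i :=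
  if h : p i then eqToHom (if_pos h).symm else 0

variable {p}

lemma isZero_brutalX {i : ℤ} (h : ¬ p i) : IsZero (K.brutalX p i) := by
  rw [brutalX, if_neg h]
  exact isZero_zero C

variable (p) in
@[simp]
lemma brutalι_π (i : ℤ) : K.brutalι p i ≫ K.brutalπ p i = 𝟙 _ := by
  by_cases h : p i
  · rw [brutalι, brutalπ, dif_pos h, dif_pos h]
    exact eqToHom_trans (if_pos h) (if_pos h).symm
  · exact (K.isZero_brutalX h).eq_of_src _ _

lemma brutalπ_ι {i : ℤ} (h : p i) : K.brutalπ p i ≫ K.brutalι p i = 𝟙 _ := by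
  rw [brutalι, brutalπ, dif_pos h, dif_pos h]
  exact eqToHom_trans (if_pos h).symm (if_pos h)

lemma brutalπ_ι_assoc {i : ℤ} (h : p i) {Z : C} (f : K.X i ⟶ Z) :
    K.brutalπ p i ≫ K.brutalι p i ≫ f = f := by
  rw [← Category.assoc, brutalπ_ι K h, Category.id_comp]

lemma brutalι_eq_zero {i : ℤ} (h : ¬ p i) : K.brutalι p i = 0 :=
  (K.isZero_brutalX h).eq_of_src _ _

lemma brutalπ_eq_zero {i : ℤ} (h : ¬ p i) : K.brutalπ p i = 0 :=
  (K.isZero_brutalX h).eq_of_tgt _ _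

variable (p) in
/-- The brutal truncation of a cochain complex `K` to the degrees which satisfy `p`. -/
@[simps]
noncomputable def brutal : CochainComplex C ℤ where
  X := K.brutalX p
  d i j := K.brutalι p i ≫ K.d i j ≫ K.brutalπ p j
  shape i j h := by rw [K.shape i j h, zero_comp, comp_zero]
  d_comp_d' i j k _ _ := by
    by_cases h : p j
    · simp [brutalπ_ι_assoc K h]
    · simp [brutalπ_eq_zero K h]

/-- A morphism which vanishes outside of the degrees where `p` holds lifts to the brutal
truncation of its target. -/
noncomputable def brutalLift {L : CochainComplex C ℤ} (f : L ⟶ K) (hf : ∀ i, ¬ p i → f.f i = 0) :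
    L ⟶ K.brutal p where
  f i := f.f i ≫ K.brutalπ p i
  comm' i j _ := by
    change (f.f i ≫ K.brutalπ p i) ≫ K.brutalι p i ≫ K.d i j ≫ K.brutalπ p j =
      L.d i j ≫ f.f j ≫ K.brutalπ p j
    rw [← f.comm_assoc, Category.assoc]
    by_cases h : p i
    · rw [brutalπ_ι_assoc K h]
    · rw [hf i h, zero_comp, zero_comp]

/-- The inclusion of the brutal truncation to an upper set of degrees. -/
noncomputable def brutalInclusion (hp : ∀ i, p i → p (i + 1)) : K.brutal p ⟶ K where
  f i := K.brutalι p i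
  comm' i j hij := by
    obtain rfl : i + 1 = j := hij
    change K.brutalι p i ≫ K.d i (i + 1) =
      (K.brutalι p i ≫ K.d i (i + 1) ≫ K.brutalπ p (i + 1)) ≫ K.brutalι p (i + 1)
    by_cases h : p i
    · rw [Category.assoc, Category.assoc, brutalπ_ι K (hp i h), Category.comp_id]
    · rw [brutalι_eq_zero K h, zero_comp, zero_comp, zero_comp]

/-- The projection to the brutal truncation to a lower set of degrees. -/
noncomputable def brutalProjection (hp : ∀ i, p (i + 1) → p i) : K ⟶ K.brutal p where
  f i := K.brutalπ p i
  comm' i j hij := by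
    obtain rfl : i + 1 = j := hij
    change K.brutalπ p i ≫ K.brutalι p i ≫ K.d i (i + 1) ≫ K.brutalπ p (i + 1) =
      K.d i (i + 1) ≫ K.brutalπ p (i + 1)
    by_cases h : p (i + 1)
    · rw [brutalπ_ι_assoc K (hp i h)]
    · rw [brutalπ_eq_zero K h, comp_zero, comp_zero, comp_zero]

lemma brutalLift_comp_inclusion {L : CochainComplex C ℤ} (f : L ⟶ K)
    (hf : ∀ i, ¬ p i → f.f i = 0) (hp : ∀ i, p i → p (i + 1)) :
    K.brutalLift f hf ≫ K.brutalInclusion hp = f := by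
  ext i
  change (f.f i ≫ K.brutalπ p i) ≫ K.brutalι p i = f.f i
  by_cases h : p i
  · rw [Category.assoc, brutalπ_ι K h, Category.comp_id]
  · rw [hf i h, zero_comp, zero_comp]

lemma isStrictlyLE_brutal_of_isStrictlyLE (n : ℤ) [K.IsStrictlyLE n] :
    (K.brutal p).IsStrictlyLE n := by
  rw [isStrictlyLE_iff]
  intro i hi
  by_cases h : p i
  · exact IsZero.of_iso (K.isZero_of_isStrictlyLE n i hi) (eqToIso (if_pos h))
  · exact K.isZero_brutalX h

variable (p) in
/-- The degreewise split short exact sequence attached to the brutal truncations of `K` at a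
lower set of degrees. -/
@[simps]
noncomputable def brutalShortComplex (hp : ∀ i, p (i + 1) → p i) :
    ShortComplex (CochainComplex C ℤ) where
  X₁ := K.brutal (fun i => ¬ p i)
  X₂ := K
  X₃ := K.brutal p
  f := K.brutalInclusion (fun i h h' => h (hp i h'))
  g := K.brutalProjection hp
  zero := by
    ext i
    change K.brutalι (fun i => ¬ p i) i ≫ K.brutalπ p i = 0
    by_cases h : p i
    · rw [brutalι_eq_zero K (p := fun i => ¬ p i) (not_not_intro h), zero_comp]
    · rw [brutalπ_eq_zero K h, comp_zero]

/-- The degreewise splittings of `brutalShortComplex`. -/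
noncomputable def brutalSplitting (hp : ∀ i, p (i + 1) → p i) (i : ℤ) :
    ((K.brutalShortComplex p hp).map (HomologicalComplex.eval C _ i)).Splitting where
  r := K.brutalπ (fun i => ¬ p i) i
  s := K.brutalι p i
  f_r := K.brutalι_π (fun i => ¬ p i) i
  s_g := K.brutalι_π p i
  id := by
    change K.brutalπ (fun i => ¬ p i) i ≫ K.brutalι (fun i => ¬ p i) i +
      K.brutalπ p i ≫ K.brutalι p i = 𝟙 _
    by_cases h : p i
    · rw [brutalπ_eq_zero K (p := fun i => ¬ p i) (not_not_intro h), zero_comp, zero_add,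
        brutalπ_ι K h]
    · rw [brutalπ_eq_zero K h, zero_comp, add_zero, brutalπ_ι K (p := fun i => ¬ p i) h]

end BrutalTruncation

/-! ### Morphisms from complexes whose cocycles extend -/

section ExtendsCocycles

variable {C : Type u} [Category.{v} C] [Preadditive C]

/-- Morphisms to `F` from the term of degree `i` of `P` which vanish on the boundaries extend
along the differential. -/
def ExtendsCocyclesAt (P : CochainComplex C ℤ) (F : C) (i : ℤ) : Prop :=
  ∀ φ : P.X i ⟶ F, P.d (i - 1) i ≫ φ = 0 → ∃ ψ : P.X (i + 1) ⟶ F, P.d i (i + 1) ≫ ψ = φ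

/-- If cocycles on `P` in negative degrees extend, then any morphism from `P` to a bounded below
complex is homotopic to a morphism which vanishes in negative degrees. -/
lemma exists_homotopic_vanishing {P Q : CochainComplex C ℤ}
    (hP : ∀ i < 0, P.ExtendsCocyclesAt (Q.X i) i)
    (a : ℤ) [Q.IsStrictlyGE a] (f : P ⟶ Q) :
    ∃ g : P ⟶ Q, (HomotopyCategory.quotient C (.up ℤ)).map g =
      (HomotopyCategory.quotient C (.up ℤ)).map f ∧ ∀ i < 0, g.f i = 0 := by
  -- The degrees are cleared one at a time upwards from the lower bound `a` of `Q`; at most `-a` of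
  -- them are negative.
  suffices ∀ k : ℕ, ∃ g : P ⟶ Q, (HomotopyCategory.quotient C (.up ℤ)).map g =
      (HomotopyCategory.quotient C (.up ℤ)).map f ∧ ∀ i < min 0 (a + k), g.f i = 0 by
    obtain ⟨g, hg, h⟩ := this (-a).toNat
    exact ⟨g, hg, fun i hi => h i (by lia)⟩
  intro k
  induction k with
  | zero => exact ⟨f, rfl, fun i hi => (Q.isZero_of_isStrictlyGE a i (by lia)).eq_of_tgt _ _⟩
  | succ k ih =>
    obtain ⟨g, hg, h⟩ := ih
    by_cases hk : 0 ≤ a + k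
    · exact ⟨g, hg, fun i hi => h i (by lia)⟩
    -- Since `g` already vanishes one degree lower, its component in degree `a + k` is a cocycle.
    obtain ⟨ψ, hψ⟩ := hP (a + k) (by lia) (g.f _) (by
      rw [← g.comm, h _ (by lia), zero_comp])
    -- The homotopy has `ψ` as its only component. Subtracting its boundary cancels `g` in degree `a
    -- + k` and changes nothing below.
    let s : ∀ i j, P.X i ⟶ Q.X j := fun i j =>
      if h : i = a + k + 1 ∧ j = a + k then
        eqToHom (by rw [h.1]) ≫ ψ ≫ eqToHom (by rw [h.2]) else 0
    refine ⟨g - Homotopy.nullHomotopicMap s, ?_, fun i hi => ?_⟩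
    · rw [Functor.map_sub, HomotopyCategory.eq_of_homotopy _ _ (Homotopy.nullHomotopy s ?_)]
      · simp [hg]
      · intro i j hij
        refine dif_neg ?_
        rintro ⟨rfl, rfl⟩
        exact hij rfl
    · rw [HomologicalComplex.sub_f_apply, Homotopy.nullHomotopicMap_f (k₂ := i - 1) (k₀ := i + 1)
        (by simp) (by simp)]
      by_cases hi' : i = a + k
      · subst hi'
        have h₁ : s (a + k + 1) (a + k) = ψ := by simp [s]
        have h₂ : s (a + k) (a + k - 1) = 0 := dif_neg fun h => by have := h.1; omega
        rw [h₁, h₂, hψ, zero_comp, add_zero, sub_self]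
      · rw [h i (by lia)]
        have h₁ : s (i + 1) i = 0 := dif_neg fun h => hi' h.2
        have h₂ : s i (i - 1) = 0 := dif_neg fun h => by
          have := h.1
          clear_value s
          push_cast at hi
          omega
        simp [h₁, h₂]

/-- Any morphism from `P` to a bounded complex factors up to homotopy through a bounded complex
in nonnegative degrees. -/
lemma exists_factorization_nonneg [HasZeroObject C] {P Q : CochainComplex C ℤ}
    (hP : ∀ i < 0, P.ExtendsCocyclesAt (Q.X i) i) (a b : ℤ) [Q.IsStrictlyGE a] [Q.IsStrictlyLE b]
    (f : P ⟶ Q) :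
    ∃ (Q' : CochainComplex C ℤ) (_ : Q'.IsStrictlyGE 0) (_ : Q'.IsStrictlyLE b) (g : P ⟶ Q')
      (h : Q' ⟶ Q), (HomotopyCategory.quotient C (.up ℤ)).map (g ≫ h) =
        (HomotopyCategory.quotient C (.up ℤ)).map f := by
  obtain ⟨g, hg, h⟩ := exists_homotopic_vanishing hP a f
  refine ⟨Q.brutal (0 ≤ ·), ?_, Q.isStrictlyLE_brutal_of_isStrictlyLE b,
    Q.brutalLift g (fun i hi => h i (by lia)), Q.brutalInclusion (fun i hi => by lia), ?_⟩
  · rw [isStrictlyGE_iff]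
    exact fun i hi => Q.isZero_brutalX (by lia)
  · rw [brutalLift_comp_inclusion, hg]

end ExtendsCocycles

end CochainComplex

/-! ### Morphisms in Verdier quotients -/

section VerdierQuotient

variable {T : Type u} [Category.{v} T] [HasZeroObject T] [Preadditive T] [HasShift T ℤ]
  [∀ n : ℤ, (shiftFunctor T n).Additive] [Pretriangulated T]

/-- The cone of `0 ⟶ X` is `X`, so this morphism is inverted as soon as `X` lies in `P`. -/
lemma CategoryTheory.ObjectProperty.isZero_trW_Q_obj [IsTriangulated T] (P : ObjectProperty T)
    [P.IsTriangulated] {X : T} (hX : P X) : IsZero (P.trW.Q.obj X) := by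
  have h : P.trW (0 : 0 ⟶ X) := by
    rw [P.trW_iff]
    exact ⟨X, 𝟙 X, 0, contractible_distinguished₁ X, hX⟩
  have := Localization.inverts P.trW.Q P.trW _ h
  exact (P.trW.Q.map_isZero (isZero_zero T)).of_iso (asIso (P.trW.Q.map (0 : 0 ⟶ X))).symm

/-- A morphism which vanishes in the Verdier quotient by `P` factors through an object of `P`. -/
lemma CategoryTheory.ObjectProperty.exists_factorization_of_trW_Q_map_eq_zero [IsTriangulated T]
    (P : ObjectProperty T) [P.IsTriangulated] {X Y : T} {f : X ⟶ Y} (hf : P.trW.Q.map f = 0) :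
    ∃ (Z : T) (_ : P Z) (a : X ⟶ Z) (b : Z ⟶ Y), f = a ≫ b := by
  obtain ⟨Y', s, hs, eq⟩ := (MorphismProperty.map_eq_iff_postcomp P.trW.Q P.trW f 0).1
    (by rw [hf, Functor.map_zero])
  rw [zero_comp] at eq
  -- The object of `P` is taken as the first vertex of a triangle through `s`, so that a morphism
  -- killed by `s` lifts to it.
  rw [P.trW_iff'] at hs
  obtain ⟨Z, g, k, hT, hZ⟩ := hs
  obtain ⟨q : X ⟶ Z, hq : f = q ≫ g⟩ := Triangle.coyoneda_exact₂ _ hT f eq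
  exact ⟨Z, hZ, q, g, hq⟩

/-- If all morphisms from `X` to objects of `P` factor through objects without nonzero morphisms
to `Y`, then the map from the morphisms `X ⟶ Y` to those in the Verdier quotient by `P` is
injective. -/
lemma CategoryTheory.ObjectProperty.trW_Q_map_injective [IsTriangulated T] (P : ObjectProperty T)
    [P.IsTriangulated] {X Y : T}
    (h : ∀ (Z : T) (_ : P Z) (f : X ⟶ Z), ∃ (Z' : T) (a : X ⟶ Z') (b : Z' ⟶ Z),
      a ≫ b = f ∧ ∀ c : Z' ⟶ Y, c = 0)
    {f : X ⟶ Y} (hf : P.trW.Q.map f = 0) : f = 0 := by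
  obtain ⟨Z, hZ, q, g, rfl⟩ := P.exists_factorization_of_trW_Q_map_eq_zero hf
  obtain ⟨Z', a, b, rfl, hc⟩ := h Z hZ q
  rw [Category.assoc, hc (b ≫ g), comp_zero]

/-- If all morphisms from `X` to objects of `P` factor through objects of `P` without nonzero
morphisms to `Y⟦1⟧`, then the map from the morphisms `X ⟶ Y` to those in the Verdier quotient by
`P` is surjective. -/
lemma CategoryTheory.ObjectProperty.trW_Q_map_surjective [IsTriangulated T] (P : ObjectProperty T)
    [P.IsTriangulated] {X Y : T}
    (h : ∀ (Z : T) (_ : P Z) (f : X ⟶ Z), ∃ (Z' : T) (_ : P Z') (a : X ⟶ Z') (b : Z' ⟶ Z),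
      a ≫ b = f ∧ ∀ c : Z' ⟶ Y⟦(1 : ℤ)⟧, c = 0)
    (φ : P.trW.Q.obj X ⟶ P.trW.Q.obj Y) : ∃ f : X ⟶ Y, P.trW.Q.map f = φ := by
  obtain ⟨ψ, rfl⟩ := Localization.exists_leftFraction P.trW.Q P.trW φ
  obtain ⟨Z, g, k, hT, hZ⟩ := ψ.hs
  -- The obstruction to lifting `ψ.f` along `ψ.s` is its composite to the cone `Z`. Because `Z'` has
  -- no maps to `Y⟦1⟧`, the map `b` lifts to `w : Z' ⟶ ψ.Y'`. Subtracting `a ≫ w`, which is zero in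
  -- the quotient, removes the obstruction.
  obtain ⟨Z', hZ', a, b, hab, hc⟩ := h Z hZ (ψ.f ≫ g)
  obtain ⟨w : Z' ⟶ ψ.Y', hw : b = w ≫ g⟩ := Triangle.coyoneda_exact₃ _ hT b (hc _)
  obtain ⟨f : X ⟶ Y, hf : ψ.f - a ≫ w = f ≫ ψ.s⟩ := Triangle.coyoneda_exact₂ _ hT (ψ.f - a ≫ w) (by
    change (ψ.f - a ≫ w) ≫ g = 0
    rw [Preadditive.sub_comp, Category.assoc, ← hw, hab, sub_self])
  have hs := Localization.inverts P.trW.Q P.trW ψ.s ψ.hs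
  refine ⟨f, ?_⟩
  rw [← cancel_mono (P.trW.Q.map ψ.s), ← Functor.map_comp, ← hf, Functor.map_sub, Functor.map_comp,
    (P.isZero_trW_Q_obj hZ').eq_of_src (P.trW.Q.map w) 0, comp_zero, sub_zero,
    MorphismProperty.LeftFraction.map_comp_map_s]

/-! ### Presilting objects -/

lemma IsPresilting.of_iso {X Y : T} (hX : IsPresilting X) (e : X ≅ Y) : IsPresilting Y := by
  intro n hn f
  have h := hX n hn (e.hom ≫ f ≫ (shiftFunctor T n).map e.inv)
  rw [← cancel_epi e.hom, ← cancel_mono ((shiftFunctor T n).map e.inv), Category.assoc, h,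
    comp_zero, zero_comp]

lemma IsPresilting.shift {X : T} (hX : IsPresilting X) (k : ℤ) : IsPresilting (X⟦k⟧) := by
  intro n hn f
  obtain ⟨g, hg⟩ := (shiftFunctor T k).map_surjective (f ≫ (shiftComm X k n).hom)
  rw [← cancel_mono (shiftComm X k n).hom, ← hg, hX n hn g, Functor.map_zero, zero_comp]

end VerdierQuotient

/-! ### Extension of cocycles -/

namespace CochainComplex

section

variable {C : Type u} [Category.{v} C] [Preadditive C]

lemma extendsCocyclesAt_iff (K : CochainComplex C ℤ) (F : C) (h i j : ℤ) (hi : h + 1 = i)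
    (hj : i + 1 = j) :
    K.ExtendsCocyclesAt F i ↔
      ∀ φ : K.X i ⟶ F, K.d h i ≫ φ = 0 → ∃ ψ : K.X j ⟶ F, K.d i j ≫ ψ = φ := by
  obtain rfl : h = i - 1 := by lia
  subst hj
  rfl

/-- The extension of cocycles in degree `i` depends only on the terms of degree close to `i`. -/
lemma extendsCocyclesAt_iff_of_isIso {K L : CochainComplex C ℤ} (f : K ⟶ L) (F : C) (i : ℤ)
    [IsIso (f.f (i - 1))] [IsIso (f.f i)] [IsIso (f.f (i + 1))] :
    K.ExtendsCocyclesAt F i ↔ L.ExtendsCocyclesAt F i := by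
  constructor
  · intro h φ hφ
    obtain ⟨ψ, hψ⟩ := h (f.f i ≫ φ) (by rw [← f.comm_assoc, hφ, comp_zero])
    refine ⟨inv (f.f (i + 1)) ≫ ψ, ?_⟩
    rw [← cancel_epi (f.f i), f.comm_assoc, IsIso.hom_inv_id_assoc, hψ]
  · intro h φ hφ
    obtain ⟨ψ, hψ⟩ := h (inv (f.f i) ≫ φ) (by
      rw [← cancel_epi (f.f (i - 1)), f.comm_assoc, IsIso.hom_inv_id_assoc, hφ, comp_zero])
    refine ⟨f.f (i + 1) ≫ ψ, ?_⟩
    rw [← f.comm_assoc, hψ, IsIso.hom_inv_id_assoc]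

/-- The differentials of the shift differ only by a sign, which is absorbed into the extension `ψ`.
-/
lemma ExtendsCocyclesAt.of_shift {K : CochainComplex C ℤ} {F : C} {d i j : ℤ}
    (h : (K⟦d⟧).ExtendsCocyclesAt F i) (hj : i + d = j) : K.ExtendsCocyclesAt F j := by
  rw [extendsCocyclesAt_iff K F (i - 1 + d) j (i + 1 + d) (by lia) (by lia)]
  subst hj
  intro φ hφ
  obtain ⟨ψ : K.X (i + 1 + d) ⟶ F, hψ⟩ := h φ (by
    change (d.negOnePow • K.d (i - 1 + d) (i + d)) ≫ φ = 0
    rw [Linear.units_smul_comp, hφ, smul_zero])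
  refine ⟨d.negOnePow • ψ, ?_⟩
  change (d.negOnePow • K.d (i + d) (i + 1 + d)) ≫ ψ = φ at hψ
  rw [Linear.comp_units_smul, ← Linear.units_smul_comp]
  exact hψ

lemma ExtendsCocyclesAt.of_map {D : Type*} [Category* D] [Preadditive D] (G : C ⥤ D) [G.Additive]
    [G.Full] [G.Faithful] {K : CochainComplex C ℤ} {F : C} {i : ℤ}
    (h : ExtendsCocyclesAt ((G.mapHomologicalComplex (.up ℤ)).obj K) (G.obj F) i) :
    K.ExtendsCocyclesAt F i := by
  intro φ hφ
  obtain ⟨ψ, hψ⟩ := h (G.map φ) (by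
    change G.map _ ≫ G.map _ = 0
    rw [← G.map_comp, hφ, G.map_zero])
  obtain ⟨ψ, rfl⟩ := G.map_surjective ψ
  exact ⟨ψ, G.map_injective ((G.map_comp _ _).trans hψ)⟩

end

/-- If cocycles with values in the ring extend, then so do cocycles with values in finitely
generated projective modules. -/
lemma ExtendsCocyclesAt.of_finite_projective {R : Type u} [Ring R]
    {K : CochainComplex (ModuleCat.{u} R) ℤ} {i : ℤ}
    (h : K.ExtendsCocyclesAt (ModuleCat.of R R) i) (F : ModuleCat.{u} R) [Module.Finite R F]
    [Module.Projective R F] : K.ExtendsCocyclesAt F i := by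
  intro φ hφ
  -- `F` is a retract of `R^n`: the coordinates of `s ∘ φ` are extended one by one and reassembled
  -- with `p`.
  obtain ⟨n, p, s, -, -, hps⟩ := Module.Finite.exists_comp_eq_id_of_projective R F
  have (k : Fin n) := h (φ ≫ ModuleCat.ofHom (LinearMap.proj k ∘ₗ s)) (by
    rw [← Category.assoc, hφ, zero_comp])
  choose ψ hψ using this
  refine ⟨ModuleCat.ofHom (p ∘ₗ LinearMap.pi fun k => (ψ k).hom), ?_⟩
  ext x
  have h₁ : (LinearMap.pi fun k => (ψ k).hom) ((K.d i (i + 1)).hom x) = s (φ.hom x) := by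
    ext k
    exact congr($(hψ k).hom x)
  change p ((LinearMap.pi fun k => (ψ k).hom) ((K.d i (i + 1)).hom x)) = φ.hom x
  rw [h₁]
  exact congr($hps (φ.hom x))

end CochainComplex

/-! ### Ext groups as obstructions to extending cocycles -/

namespace CategoryTheory.ProjectiveResolution

open Abelian

/-- The vanishing of `Ext` in positive degrees in terms of the extension of cocycles on a
projective resolution. -/
lemma extendsCocyclesAt_iff_subsingleton_ext {C : Type u} [Category.{v} C] [Abelian C]
    [HasExt.{v} C] {X : C} (R : ProjectiveResolution X) (Y : C) (k : ℕ) (hk : 1 ≤ k) :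
    R.cochainComplex.ExtendsCocyclesAt Y (-k) ↔ Subsingleton (Ext.{v} X Y k) := by
  obtain ⟨k, rfl⟩ := Nat.exists_eq_add_of_le' hk
  rw [CochainComplex.extendsCocyclesAt_iff _ _ (-(k + 2 : ℕ)) _ (-k) (by lia) (by lia),
    R.cochainComplex_d (-(k + 2 : ℕ)) (-(k + 1 : ℕ)) (k + 2) (k + 1),
    R.cochainComplex_d (-(k + 1 : ℕ)) (-k) (k + 1) k]
  constructor
  · intro h
    -- A class is represented by a cocycle on the resolution and is zero exactly when this cocycle
    -- factors through the differential.
    refine subsingleton_of_forall_eq 0 fun α => ?_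
    obtain ⟨f, hf, rfl⟩ := R.extMk_surjective α (k + 2) rfl
    rw [R.extMk_eq_zero_iff f (k + 2) rfl hf k rfl]
    obtain ⟨ψ, hψ⟩ := h ((R.cochainComplexXIso (-(k + 1 : ℕ)) (k + 1)).hom ≫ f) (by simp [hf])
    refine ⟨(R.cochainComplexXIso (-k) k).inv ≫ ψ, ?_⟩
    rw [← cancel_epi (R.cochainComplexXIso (-(k + 1 : ℕ)) (k + 1)).hom, ← hψ]
    simp
  · intro h φ hφ
    rw [Category.assoc, Category.assoc] at hφ
    obtain ⟨ψ, hψ⟩ := (R.extMk_eq_zero_iff _ (k + 2) rfl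
      ((cancel_epi _).1 (hφ.trans comp_zero.symm)) k rfl).1 (Subsingleton.elim _ _)
    refine ⟨(R.cochainComplexXIso (-k) k).hom ≫ ψ, ?_⟩
    simp [hψ]

end CategoryTheory.ProjectiveResolution

/-! ### The nonpositive part of a complex as a projective resolution -/

namespace CochainComplex

open ComplexShape

section

variable {C : Type u} [Category.{v} C] [Preadditive C] [HasZeroObject C] (K : CochainComplex C ℤ)

/-- The projection of a cochain complex to its part in nonpositive degrees. -/
noncomputable def toExtendRestriction :
    K ⟶ HomologicalComplex.extend (K.restriction embeddingDownNat) embeddingDownNat :=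
  embeddingDownNat.liftExtend (𝟙 (K.restriction embeddingDownNat))
    -- The lifting condition concerns degrees in the image whose predecessor is not; the nonpositive
    -- degrees have none.
    (show embeddingDownNat.HasLift _ from fun _ hj => hj.false_of_isTruncLE.elim)

lemma isIso_toExtendRestriction_f (i : ℤ) (hi : i ≤ 0) : IsIso (K.toExtendRestriction.f i) := by
  have h : embeddingDownNat.f (-i).toNat = i := by
    change -((-i).toNat : ℤ) = i
    lia
  have h' : K.toExtendRestriction.f i = (K.restrictionXIso embeddingDownNat h).inv ≫
      𝟙 _ ≫ (HomologicalComplex.extendXIso _ embeddingDownNat h).inv :=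
    embeddingDownNat.liftExtend_f _ _ h
  rw [h']
  infer_instance

instance isIso_toExtendRestriction [K.IsStrictlyLE 0] : IsIso K.toExtendRestriction := by
  have (i : ℤ) : IsIso (K.toExtendRestriction.f i) := by
    by_cases hi : i ≤ 0
    · exact K.isIso_toExtendRestriction_f i hi
    · refine isIso_of_source_target_iso_zero _ (IsZero.isoZero ?_) (IsZero.isoZero ?_)
      · exact K.isZero_of_isStrictlyLE 0 i (by lia)
      · refine HomologicalComplex.isZero_extend_X _ _ _ fun k hk => hi ?_
        rw [← hk]
        change -(k : ℤ) ≤ 0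
        lia
  exact HomologicalComplex.Hom.isIso_of_components _

end

end CochainComplex

namespace CategoryTheory.ProjectiveResolution

variable {A : Type u} [Category.{v} A] [Abelian A]

open ComplexShape

/-- The projective resolution given by an exact augmented complex of projective objects. -/
noncomputable def ofExact (L : ChainComplex A ℕ) [∀ n, Projective (L.X n)]
    (hL : ∀ n, L.ExactAt (n + 1)) {Z : A} (π : L.X 0 ⟶ Z) [Epi π] (w : L.d 1 0 ≫ π = 0)
    (hπ : (ShortComplex.mk _ _ w).Exact) : ProjectiveResolution Z where
  complex := L
  π := (ChainComplex.toSingle₀Equiv _ _).symm ⟨π, w⟩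
  quasiIso := ⟨fun n => by
    cases n with
    | zero =>
      rw [ChainComplex.quasiIsoAt₀_iff, ShortComplex.quasiIso_iff_of_zeros']
      · refine (ShortComplex.exact_and_epi_g_iff_of_iso ?_).2
          (⟨hπ, inferInstanceAs (Epi π)⟩ : _ ∧ _)
        refine ShortComplex.isoMk (Iso.refl _) (Iso.refl _) (Iso.refl _) ?_ ?_
        · exact (Category.id_comp _).trans (Category.comp_id _).symm
        · erw [Category.id_comp, Category.comp_id]
          exact (ChainComplex.toSingle₀Equiv_symm_apply_f_zero π w).symm
      · exact L.shape _ _ (by simp)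
      all_goals rfl
    | succ n =>
      rw [quasiIsoAt_iff_exactAt']
      · exact hL n
      · apply ChainComplex.exactAt_succ_single_obj⟩

/-- The projective resolution given by the part in nonpositive degrees of a cochain complex of
projective objects which is exact in negative degrees. -/
noncomputable def ofCochainComplex (K : CochainComplex A ℤ) [K.IsGE 0]
    [∀ i, Projective (K.X i)] :
    ProjectiveResolution (cokernel ((K.restriction embeddingDownNat).d 1 0)) :=
  have (n : ℕ) : Projective ((K.restriction embeddingDownNat).X n) :=
    inferInstanceAs (Projective (K.X _))
  ofExact (K.restriction embeddingDownNat) (fun n => by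
    rw [HomologicalComplex.exactAt_iff' _ (n + 2) (n + 1) n (by simp) (by simp)]
    refine ShortComplex.exact_of_iso (HomologicalComplex.restriction.sc'Iso K embeddingDownNat
      (n + 2) (n + 1) n (i' := -(n + 2 : ℕ)) (j' := -(n + 1 : ℕ)) (k' := -(n : ℕ))
      rfl rfl rfl (by simp; lia) (by simp)).symm ?_
    rw [← HomologicalComplex.exactAt_iff' K _ _ _ (by simp; lia) (by simp)]
    exact K.exactAt_of_isGE 0 _ (by lia)) (cokernel.π _) (cokernel.condition _)
    (ShortComplex.exact_cokernel _)

end CategoryTheory.ProjectiveResolution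

/-! ### Resolutions by finitely generated projective modules -/

namespace SingularityCategory

section Resolution

variable {R : Type u} [Ring R]

/-- The bundled finitely generated modules. -/
abbrev FGMod (R : Type u) [Ring R] := { N : ModuleCat.{u} R // Module.Finite R N }

lemma exists_freeCover (N : FGMod R) :
    ∃ (n : ℕ) (f : (Fin n → R) →ₗ[R] N.1), Function.Surjective f :=
  have := N.2
  Module.Finite.exists_fin' R N.1

/-- The rank of a free module which surjects onto `N`. -/
noncomputable def coverRank (N : FGMod R) : ℕ := (exists_freeCover N).choose

/-- A surjection from a free module of finite rank. -/
noncomputable def cover (N : FGMod R) : (Fin (coverRank N) → R) →ₗ[R] N.1 :=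
  (exists_freeCover N).choose_spec.choose

lemma cover_surjective (N : FGMod R) : Function.Surjective (cover N) :=
  (exists_freeCover N).choose_spec.choose_spec

variable [IsNoetherianRing R]

/-- The iterated syzygies of a finitely generated module. -/
noncomputable def syzygy (N : FGMod R) : ℕ → FGMod R
  | 0 => N
  | k + 1 => ⟨ModuleCat.of R (LinearMap.ker (cover (syzygy N k))),
      inferInstanceAs (Module.Finite R (LinearMap.ker (cover (syzygy N k))))⟩

/-- The differential of the resolution of `N` by free modules of finite rank. -/
noncomputable def freeResolutionD (N : FGMod R) (k : ℕ) :
    (Fin (coverRank (syzygy N (k + 1))) → R) →ₗ[R] (Fin (coverRank (syzygy N k)) → R) :=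
  (LinearMap.ker (cover (syzygy N k))).subtype ∘ₗ cover (syzygy N (k + 1))

lemma range_freeResolutionD (N : FGMod R) (k : ℕ) :
    LinearMap.range (freeResolutionD N k) = LinearMap.ker (cover (syzygy N k)) := by
  refine (LinearMap.range_comp_of_range_eq_top _ ?_).trans (Submodule.range_subtype _)
  exact LinearMap.range_eq_top.2 (cover_surjective _)

lemma ker_freeResolutionD (N : FGMod R) (k : ℕ) :
    LinearMap.ker (freeResolutionD N k) = LinearMap.ker (cover (syzygy N (k + 1))) :=
  LinearMap.ker_comp_of_ker_eq_bot _ (Submodule.ker_subtype _)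

lemma freeResolutionD_comp (N : FGMod R) (k : ℕ) :
    freeResolutionD N k ∘ₗ freeResolutionD N (k + 1) = 0 := by
  rw [← LinearMap.range_le_ker_iff, range_freeResolutionD, ker_freeResolutionD]

/-- The resolution of `N` by free modules of finite rank. -/
noncomputable def freeResolutionComplex (N : FGMod R) : ChainComplex (ModuleCat.{u} R) ℕ :=
  ChainComplex.of (fun k => ModuleCat.of R (Fin (coverRank (syzygy N k)) → R))
    (fun k => ModuleCat.ofHom (freeResolutionD N k))
    (fun k => ModuleCat.hom_ext (freeResolutionD_comp N k))

lemma fgProj_freeResolutionComplex_X (N : FGMod R) (k : ℕ) :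
    fgProj R ((freeResolutionComplex N).X k) :=
  ⟨inferInstanceAs (Module.Finite R (Fin (coverRank (syzygy N k)) → R)),
    inferInstanceAs (Module.Projective R (Fin (coverRank (syzygy N k)) → R))⟩

/-- A finitely generated module over a noetherian ring has a resolution by finitely generated
projective modules. -/
lemma exists_fgProj_resolution (M : ModuleCat.{u} R) [Module.Finite R M] :
    ∃ Q : ProjectiveResolution M, ∀ k, fgProj R (Q.complex.X k) := by
  let N : FGMod R := ⟨M, inferInstance⟩
  have (k : ℕ) : Projective ((freeResolutionComplex N).X k) :=
    (IsProjective.iff_projective _).1 (fgProj_freeResolutionComplex_X N k).2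
  have d_eq (k : ℕ) : (freeResolutionComplex N).d (k + 1) k =
      ModuleCat.ofHom (freeResolutionD N k) := ChainComplex.of_d
      (X := fun k => ModuleCat.of R (Fin (coverRank (syzygy N k)) → R))
      (fun k => ModuleCat.ofHom (freeResolutionD N k)) k
  let π : (freeResolutionComplex N).X 0 ⟶ M := ModuleCat.ofHom (cover N)
  have : Epi π := (ModuleCat.epi_iff_surjective _).2 (cover_surjective N)
  refine ⟨ProjectiveResolution.ofExact (freeResolutionComplex N) (fun k => ?_)
    π ?_ ?_, fun k => fgProj_freeResolutionComplex_X N k⟩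
  · rw [HomologicalComplex.exactAt_iff' _ (k + 2) (k + 1) k (by simp) (by simp),
      ShortComplex.moduleCat_exact_iff_range_eq_ker]
    change LinearMap.range ((freeResolutionComplex N).d (k + 1 + 1) (k + 1)).hom =
      LinearMap.ker ((freeResolutionComplex N).d (k + 1) k).hom
    rw [d_eq, d_eq]
    exact (range_freeResolutionD N (k + 1)).trans (ker_freeResolutionD N k).symm
  · rw [d_eq]
    exact ModuleCat.hom_ext (LinearMap.range_le_ker_iff.1 (range_freeResolutionD N 0).le)
  · rw [ShortComplex.moduleCat_exact_iff_range_eq_ker]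
    change LinearMap.range ((freeResolutionComplex N).d (0 + 1) 0).hom =
      LinearMap.ker (cover N)
    rw [d_eq]
    exact range_freeResolutionD N 0

end Resolution

end SingularityCategory

/-- Artin algebras are left noetherian. -/
lemma IsArtinAlgebra.isNoetherianRing {Λ : Type u} [Ring Λ] (hΛ : IsArtinAlgebra Λ) :
    IsNoetherianRing Λ := by
  have := hΛ.isArtinianRing_center
  have := hΛ.finite_center
  have : IsNoetherian (Subring.center Λ) Λ := inferInstance
  exact isNoetherian_of_tower (Subring.center Λ) this

/-! ### Comparison of morphisms in the homotopy and singularity categories -/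

namespace SingularityCategory

section

variable {R : Type u} [Ring R]

/-- The complex of modules underlying a complex of finitely generated projective modules. -/
noncomputable abbrev moduleComplex (P : CochainComplex (Proj R) ℤ) :
    CochainComplex (ModuleCat.{u} R) ℤ :=
  ((fgProj R).ι.mapHomologicalComplex (.up ℤ)).obj P

instance (P : CochainComplex (Proj R) ℤ) (i : ℤ) : Projective ((moduleComplex P).X i) :=
  (IsProjective.iff_projective _).1 (P.X i).property.2

lemma isZero_homology_quotient_iff (K : CochainComplex (ModuleCat.{u} R) ℤ) (i : ℤ) :
    IsZero ((HomotopyCategory.homologyFunctor (ModuleCat.{u} R) (.up ℤ) i).obj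
      ((HomotopyCategory.quotient _ _).obj K)) ↔ K.ExactAt i := by
  rw [HomologicalComplex.exactAt_iff_isZero_homology]
  exact ((HomotopyCategory.homologyFunctorFactors (ModuleCat.{u} R) (.up ℤ) i).app K).isZero_iff

lemma minusBounded_quotient_obj (P : CochainComplex (Proj R) ℤ) (a b : ℤ) [P.IsStrictlyLE b]
    [(moduleComplex P).IsGE a] : minusBounded R ((HomotopyCategory.quotient _ _).obj P) := by
  -- The cohomology lies in degrees between `a` and `b`, whose absolute values are both at most `|a|
  -- + |b|`.
  refine ⟨⟨b, inferInstanceAs (P.IsStrictlyLE b)⟩, |a| + |b|, fun i hi => ?_⟩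
  change IsZero ((HomotopyCategory.homologyFunctor (ModuleCat.{u} R) (.up ℤ) i).obj
      ((HomotopyCategory.quotient _ _).obj (moduleComplex P)))
  rw [isZero_homology_quotient_iff]
  by_cases h : i < a
  · exact (moduleComplex P).exactAt_of_isGE a i h
  · refine (moduleComplex P).exactAt_of_isLE b i ?_
    have h₁ := abs_nonneg a
    have h₁' := neg_abs_le a
    have h₂ := le_abs_self b
    have h₃ := abs_nonneg b
    rcases abs_cases i with h₄ | h₄ <;> lia

/-- The object of `K^{-,b}(R-proj)` given by a bounded above complex of finitely generated
projective modules which is exact in small degrees. -/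
noncomputable abbrev kMinusBoundedOf (P : CochainComplex (Proj R) ℤ) (a b : ℤ) [P.IsStrictlyLE b]
    [(moduleComplex P).IsGE a] : KMinusBounded R :=
  ⟨(HomotopyCategory.quotient _ _).obj P, minusBounded_quotient_obj P a b⟩

lemma exists_isGE_moduleComplex (X : KMinusBounded R) : ∃ a, (moduleComplex X.obj.as).IsGE a := by
  obtain ⟨N, hN⟩ := X.property.2
  refine ⟨-N, ?_⟩
  rw [CochainComplex.isGE_iff]
  intro i hi
  rw [← isZero_homology_quotient_iff]
  exact hN i (by rcases abs_cases i with h | h <;> lia)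

/-- Morphisms to perfect complexes from a complex whose cocycles with values in projective modules
extend factor through perfect complexes in nonnegative degrees. -/
lemma exists_factorization_perfect {X Z : KMinusBounded R}
    (hX : ∀ (F : Proj R), ∀ i < 0, CochainComplex.ExtendsCocyclesAt X.obj.as F i)
    (hZ : perfect R Z) (f : X ⟶ Z) :
    ∃ (Z' : KMinusBounded R) (_ : perfect R Z') (a : X ⟶ Z') (b : Z' ⟶ Z),
      a ≫ b = f ∧ CochainComplex.IsStrictlyGE Z'.obj.as 0 := by
  obtain ⟨W, ⟨⟨m, hm⟩, n, hn⟩, ⟨e⟩⟩ := hZ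
  obtain ⟨g : X.obj.as ⟶ W.as, hg⟩ :=
    (HomotopyCategory.quotient (Proj R) (.up ℤ)).map_surjective (f.hom ≫ e.hom)
  obtain ⟨Q, _, _, a, b, hab⟩ :=
    CochainComplex.exists_factorization_nonneg (fun i hi => hX _ i hi) m n g
  refine ⟨kMinusBoundedOf Q 0 n, ⟨_, ⟨⟨0, ?_⟩, n, ?_⟩, ⟨Iso.refl _⟩⟩,
    ObjectProperty.homMk ((HomotopyCategory.quotient _ _).map a),
    ObjectProperty.homMk ((HomotopyCategory.quotient _ _).map b ≫ e.inv), ?_, ?_⟩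
  · assumption
  · assumption
  · ext
    change (HomotopyCategory.quotient _ _).map a ≫ (HomotopyCategory.quotient _ _).map b ≫ e.inv =
      f.hom
    exact ((HomotopyCategory.quotient _ _).map_comp_assoc a b e.inv).symm.trans
      ((congrArg (· ≫ e.inv) (hab.trans hg)).trans ((Category.assoc _ _ _).trans
        ((congrArg (f.hom ≫ ·) e.hom_inv_id).trans (Category.comp_id _))))
  · assumption

/-- There are no nonzero morphisms from a complex in nonnegative degrees to a complex in negative
degrees. -/
lemma eq_zero_of_isStrictlyGE_of_iso {Z Y : KMinusBounded R}
    [hZ : CochainComplex.IsStrictlyGE Z.obj.as 0] (L : CochainComplex (Proj R) ℤ)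
    [L.IsStrictlyLE (-1)] (e : Y.obj ≅ (HomotopyCategory.quotient _ _).obj L) (f : Z ⟶ Y) :
    f = 0 := by
  obtain ⟨g : Z.obj.as ⟶ L, hg⟩ :=
    (HomotopyCategory.quotient (Proj R) (.up ℤ)).map_surjective (f.hom ≫ e.hom)
  have hg' : g = 0 := by
    ext i : 1
    by_cases hi : i < 0
    · exact (CochainComplex.isZero_of_isStrictlyGE Z.obj.as 0 i hi).eq_of_src _ _
    · exact (L.isZero_of_isStrictlyLE (-1) i (by lia)).eq_of_tgt _ _
  ext
  rw [hg', Functor.map_zero] at hg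
  exact (cancel_mono e.hom).1 (hg.symm.trans zero_comp.symm)

/-- The underlying object of a shift in `K^{-,b}(R-proj)`. -/
noncomputable def shiftObjIso (X : KMinusBounded R) (n : ℤ) :
    (X⟦n⟧).obj ≅ (HomotopyCategory.quotient (Proj R) (.up ℤ)).obj
      ((show CochainComplex (Proj R) ℤ from X.obj.as)⟦n⟧) :=
  ((minusBounded R).ι.commShiftIso n).app X ≪≫
    ((HomotopyCategory.quotient (Proj R) (.up ℤ)).commShiftIso n).symm.app X.obj.as

/-- For a complex in nonpositive degrees whose cocycles with values in projective modules extend,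
being presilting in the singularity category can be checked in the homotopy category. -/
lemma isPresilting_trW_Q_obj_iff (X : KMinusBounded R)
    [hLE : CochainComplex.IsStrictlyLE X.obj.as 0]
    (hX : ∀ (F : Proj R), ∀ i < 0, CochainComplex.ExtendsCocyclesAt X.obj.as F i) :
    IsPresilting ((perfect R).trW.Q.obj X) ↔ ∀ n : ℤ, 0 < n → ∀ f : X ⟶ X⟦n⟧, f = 0 := by
  have hshift (n : ℤ) (hn : 0 < n) :
      CochainComplex.IsStrictlyLE ((show CochainComplex (Proj R) ℤ from X.obj.as)⟦n⟧) (-1) :=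
    have := CochainComplex.isStrictlyLE_shift X.obj.as 0 n (-n) (by lia)
    CochainComplex.isStrictlyLE_of_le _ (-n) (-1) (by lia)
  constructor
  · intro h n hn f
    -- For injectivity the maps `Z' ⟶ X⟦n⟧` must vanish; as `n ≥ 1`, the target lives in degrees `≤
    -- -1`.
    refine (perfect R).trW_Q_map_injective (fun Z hZ f => ?_)
      (((cancel_mono (((perfect R).trW.Q.commShiftIso n).hom.app X)).1
        ((h n hn _).trans zero_comp.symm)))
    obtain ⟨Z', hZ', a, b, hab, _⟩ := exists_factorization_perfect hX hZ f
    have := hshift n hn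
    exact ⟨Z', a, b, hab, eq_zero_of_isStrictlyGE_of_iso _ (shiftObjIso X n)⟩
  · intro h n hn φ
    -- For surjectivity the target is `X⟦n⟧⟦1⟧`, identified with `X⟦n + 1⟧`.
    obtain ⟨f, hf⟩ := (perfect R).trW_Q_map_surjective (X := X) (Y := X⟦n⟧) (fun Z hZ f => by
      obtain ⟨Z', hZ', a, b, hab, _⟩ := exists_factorization_perfect hX hZ f
      have := hshift (n + 1) (by lia)
      exact ⟨Z', hZ', a, b, hab, eq_zero_of_isStrictlyGE_of_iso _
        ((minusBounded R).ι.mapIso ((shiftFunctorAdd' (KMinusBounded R) n 1 _ rfl).symm.app X) ≪≫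
          shiftObjIso X (n + 1))⟩)
      (φ ≫ ((perfect R).trW.Q.commShiftIso n).inv.app X)
    rw [h n hn f, Functor.map_zero] at hf
    rw [← cancel_mono (((perfect R).trW.Q.commShiftIso n).inv.app X), ← hf, zero_comp]

end

end SingularityCategory

/-! ### Self-extensions as endomorphisms of positive degree -/

section ShiftedEndomorphisms

variable {T : Type*} [Category* T] [Preadditive T] [HasShift T ℤ]

lemma forall_shiftedHom_eq_zero_of_iso [∀ n : ℤ, (shiftFunctor T n).PreservesZeroMorphisms]
    {X Y : T} (e : X ≅ Y) (n : ℤ) (h : ∀ f : X ⟶ X⟦n⟧, f = 0) (f : Y ⟶ Y⟦n⟧) : f = 0 := by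
  have h := h (e.hom ≫ f ≫ (shiftFunctor T n).map e.inv)
  rw [← cancel_epi e.hom, ← cancel_mono ((shiftFunctor T n).map e.inv), Category.assoc, h,
    comp_zero, zero_comp]

lemma CategoryTheory.Functor.forall_shiftedHom_eq_zero_iff {T' : Type*} [Category* T']
    [Preadditive T'] [HasShift T' ℤ] (G : T ⥤ T') [G.CommShift ℤ] [G.PreservesZeroMorphisms]
    {X : T} (n : ℤ) (hG : Function.Bijective (G.map : (X ⟶ X⟦n⟧) → _)) :
    (∀ f : X ⟶ X⟦n⟧, f = 0) ↔ ∀ f : G.obj X ⟶ (G.obj X)⟦n⟧, f = 0 := by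
  constructor
  · intro h f
    obtain ⟨g, hg⟩ := hG.2 (f ≫ (G.commShiftIso n).inv.app X)
    rw [h g, G.map_zero] at hg
    rw [← cancel_mono ((G.commShiftIso n).inv.app X), ← hg, zero_comp]
  · intro h f
    refine hG.1 ((cancel_mono ((G.commShiftIso n).hom.app X)).1 ?_)
    rw [G.map_zero, zero_comp]
    exact h _

end ShiftedEndomorphisms

namespace SingularityCategory

open Abelian

variable {R : Type u} [Ring R]

lemma isKProjective_moduleComplex (P : CochainComplex (Proj R) ℤ) (n : ℤ) [P.IsStrictlyLE n] :
    (moduleComplex P).IsKProjective :=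
  CochainComplex.isKProjective_of_projective _ n

attribute [local instance] HasDerivedCategory.standard in
/-- The endomorphisms of positive degree of a projective resolution are given by self-extensions. -/
lemma forall_shiftedHom_eq_zero_iff_subsingleton_ext (X : KMinusBounded R)
    [hLE : CochainComplex.IsStrictlyLE X.obj.as 0] {M : ModuleCat.{u} R}
    (Q : ProjectiveResolution M) (e : moduleComplex X.obj.as ≅ Q.cochainComplex) (n : ℕ) :
    (∀ f : X ⟶ X⟦(n : ℤ)⟧, f = 0) ↔ Subsingleton (Ext.{u} M M n) := by
  let G : KMinusBounded R ⥤ DerivedCategory (ModuleCat.{u} R) :=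
    (minusBounded R).ι ⋙ (fgProj R).ι.mapHomotopyCategory (.up ℤ) ⋙ DerivedCategory.Qh
  -- `Qh` is bijective on these morphisms because the source is bounded above with projective terms,
  -- hence K-projective. The other two functors are fully faithful.
  have hG : Function.Bijective (G.map : (X ⟶ X⟦(n : ℤ)⟧) → _) := by
    have := isKProjective_moduleComplex X.obj.as 0
    have h := CochainComplex.IsKProjective.Qh_map_bijective (moduleComplex X.obj.as)
      (((fgProj R).ι.mapHomotopyCategory (.up ℤ)).obj (X⟦(n : ℤ)⟧).obj)
    exact (h.comp ((Functor.FullyFaithful.ofFullyFaithful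
      ((fgProj R).ι.mapHomotopyCategory (.up ℤ))).map_bijective _ _)).comp
        ((minusBounded R).fullyFaithfulι.map_bijective _ _)
  let i : G.obj X ≅ (DerivedCategory.singleFunctor (ModuleCat.{u} R) 0).obj M :=
    (DerivedCategory.quotientCompQhIso _).app (moduleComplex X.obj.as) ≪≫
      DerivedCategory.Q.mapIso e ≪≫ asIso (DerivedCategory.Q.map Q.π') ≪≫
      ((DerivedCategory.singleFunctorIsoCompQ _ 0).app M).symm
  rw [G.forall_shiftedHom_eq_zero_iff n hG, Ext.homEquiv.subsingleton_congr]
  constructor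
  · intro h
    exact subsingleton_of_forall_eq 0 (forall_shiftedHom_eq_zero_of_iso i n h)
  · intro h
    exact forall_shiftedHom_eq_zero_of_iso i.symm n fun f =>
      Subsingleton.elim (α := ShiftedHom _ _ (n : ℤ)) f 0

/-- `Ext` with values in the ring controls the extension of cocycles with values in all finitely
generated projective modules. -/
lemma extendsCocyclesAt_of_subsingleton_ext {P : CochainComplex (Proj R) ℤ} {M : ModuleCat.{u} R}
    (Q : ProjectiveResolution M) (e : moduleComplex P ≅ Q.cochainComplex)
    (h : ∀ n : ℕ, 1 ≤ n → Subsingleton (Ext.{u} M (ModuleCat.of R R) n)) (F : Proj R) (i : ℤ)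
    (hi : i < 0) : P.ExtendsCocyclesAt F i := by
  obtain ⟨k, rfl⟩ := Int.exists_eq_neg_ofNat hi.le
  have := F.property.1
  have := F.property.2
  refine CochainComplex.ExtendsCocyclesAt.of_map (fgProj R).ι ?_
  refine CochainComplex.ExtendsCocyclesAt.of_finite_projective ?_ F.obj
  rw [CochainComplex.extendsCocyclesAt_iff_of_isIso e.hom,
    Q.extendsCocyclesAt_iff_subsingleton_ext _ k (by lia)]
  exact h k (by lia)

/-- Postcomposition with the inclusions and projections of the biproduct. This separates the
coefficients `M ⊕ Λ` of (ARC) into the two vanishing conditions that play different roles. -/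
lemma subsingleton_ext_prod_iff (M N L : ModuleCat.{u} R) (n : ℕ) :
    Subsingleton (Ext.{u} M (ModuleCat.of R (N × L)) n) ↔
      Subsingleton (Ext.{u} M N n) ∧ Subsingleton (Ext.{u} M L n) := by
  let p₁ : ModuleCat.of R (N × L) ⟶ N := ModuleCat.ofHom (LinearMap.fst R N L)
  let p₂ : ModuleCat.of R (N × L) ⟶ L := ModuleCat.ofHom (LinearMap.snd R N L)
  let i₁ : N ⟶ ModuleCat.of R (N × L) := ModuleCat.ofHom (LinearMap.inl R N L)
  let i₂ : L ⟶ ModuleCat.of R (N × L) := ModuleCat.ofHom (LinearMap.inr R N L)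
  have h₁ : i₁ ≫ p₁ = 𝟙 _ := rfl
  have h₂ : i₂ ≫ p₂ = 𝟙 _ := rfl
  have h : p₁ ≫ i₁ + p₂ ≫ i₂ = 𝟙 _ :=
    ModuleCat.hom_ext (LinearMap.ext fun x : N × L => Prod.ext (add_zero x.1) (zero_add x.2))
  constructor
  · intro hs
    refine ⟨subsingleton_of_forall_eq 0 fun x => ?_, subsingleton_of_forall_eq 0 fun x => ?_⟩
    · rw [← x.comp_mk₀_id, ← h₁, ← Ext.mk₀_comp_mk₀, ← Ext.comp_assoc_of_second_deg_zero,
        Subsingleton.elim (x.comp (Ext.mk₀ i₁) _) 0, Ext.zero_comp]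
    · rw [← x.comp_mk₀_id, ← h₂, ← Ext.mk₀_comp_mk₀, ← Ext.comp_assoc_of_second_deg_zero,
        Subsingleton.elim (x.comp (Ext.mk₀ i₂) _) 0, Ext.zero_comp]
  · rintro ⟨_, _⟩
    refine subsingleton_of_forall_eq 0 fun x => ?_
    rw [← x.comp_mk₀_id, ← h, Ext.mk₀_add, Ext.comp_add, ← Ext.mk₀_comp_mk₀, ← Ext.mk₀_comp_mk₀,
      ← Ext.comp_assoc_of_second_deg_zero, ← Ext.comp_assoc_of_second_deg_zero,
      Subsingleton.elim (x.comp (Ext.mk₀ p₁) _) 0, Subsingleton.elim (x.comp (Ext.mk₀ p₂) _) 0,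
      Ext.zero_comp, Ext.zero_comp, add_zero]

end SingularityCategory

/-! ### Modules whose resolution vanishes in the singularity category -/

/-- A projective resolution presents the resolved object as a cokernel. -/
lemma CategoryTheory.ProjectiveResolution.exists_augmentation {C : Type u} [Category.{v} C]
    [Abelian C] {M : C} (Q : ProjectiveResolution M) {K : CochainComplex C ℤ}
    (e : K ≅ Q.cochainComplex) :
    ∃ p : K.X 0 ⟶ M, Epi p ∧ K.d (-1) 0 ≫ p = 0 ∧
      ∀ (Y : C) (f : K.X 0 ⟶ Y), K.d (-1) 0 ≫ f = 0 → ∃ g : M ⟶ Y, p ≫ g = f := by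
  let c₀ : K.X 0 ≅ Q.complex.X 0 :=
    (HomologicalComplex.eval C _ 0).mapIso e ≪≫ Q.cochainComplexXIso 0 0
  let c₁ : K.X (-1) ≅ Q.complex.X 1 :=
    (HomologicalComplex.eval C _ (-1)).mapIso e ≪≫ Q.cochainComplexXIso (-1) 1
  have hc : K.d (-1) 0 ≫ c₀.hom = c₁.hom ≫ Q.complex.d 1 0 := by
    change K.d (-1) 0 ≫ e.hom.f 0 ≫ (Q.cochainComplexXIso 0 0).hom =
      (e.hom.f (-1) ≫ (Q.cochainComplexXIso (-1) 1).hom) ≫ Q.complex.d 1 0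
    rw [← e.hom.comm_assoc, Q.cochainComplex_d (-1) 0 1 0]
    simp
  let p : K.X 0 ⟶ M := c₀.hom ≫ (show Q.complex.X 0 ⟶ M from Q.π.f 0)
  have hπ : Epi (show Q.complex.X 0 ⟶ M from Q.π.f 0) := inferInstanceAs (Epi (Q.π.f 0))
  refine ⟨p, epi_comp _ _, ?_, fun Y f hf => ?_⟩
  · rw [reassoc_of% hc]
    exact (congrArg (c₁.hom ≫ ·) Q.complex_d_comp_π_f_zero).trans comp_zero
  · have hd : Q.complex.d 1 0 ≫ c₀.inv ≫ f = 0 := by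
      rw [← cancel_epi c₁.hom, ← reassoc_of% hc, c₀.hom_inv_id_assoc, hf, comp_zero]
    obtain ⟨g : M ⟶ Y, hg⟩ := CokernelCofork.IsColimit.desc' Q.isColimitCokernelCofork _ hd
    refine ⟨g, (Category.assoc _ _ _).trans ?_⟩
    exact (congrArg (c₀.hom ≫ ·) hg).trans (c₀.hom_inv_id_assoc f)

lemma CochainComplex.exactAt_iff_of_isIso {C : Type u} [Category.{v} C] [Abelian C]
    {K L : CochainComplex C ℤ} (f : K ⟶ L) (i : ℤ)
    [IsIso (f.f (i - 1))] [IsIso (f.f i)] [IsIso (f.f (i + 1))] :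
    K.ExactAt i ↔ L.ExactAt i := by
  rw [K.exactAt_iff' (i - 1) i (i + 1) (by simp) (by simp),
    L.exactAt_iff' (i - 1) i (i + 1) (by simp) (by simp)]
  let e₁ : K.X (i - 1) ≅ L.X (i - 1) := asIso (f.f (i - 1))
  let e₂ : K.X i ≅ L.X i := asIso (f.f i)
  let e₃ : K.X (i + 1) ≅ L.X (i + 1) := asIso (f.f (i + 1))
  exact ShortComplex.exact_iff_of_iso (ShortComplex.isoMk e₁ e₂ e₃ (f.comm _ _) (f.comm _ _))

lemma CochainComplex.isIso_brutalProjection_f {C : Type u} [Category.{v} C] [Preadditive C]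
    [HasZeroObject C] (K : CochainComplex C ℤ) {p : ℤ → Prop} [DecidablePred p]
    (hp : ∀ i, p (i + 1) → p i) {i : ℤ} (hi : p i) : IsIso ((K.brutalProjection hp).f i) :=
  ⟨K.brutalι p i, K.brutalπ_ι hi, K.brutalι_π p i⟩

/-- The correction `h ≫ d` coming from a homotopy lands in boundaries, so the augmentation `p` kills
it. -/
lemma CategoryTheory.Functor.map_comp_eq_of_id_eq_add {C D : Type*} [Category* C] [Category* D]
    [Preadditive C] [Preadditive D] (F : C ⥤ D) [F.Additive] {A B : C} {φ : A ⟶ A} {h : A ⟶ B}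
    {d : B ⟶ A} (hφ : 𝟙 A = φ + h ≫ d) {M : D} {p : F.obj A ⟶ M} (hp : F.map d ≫ p = 0) :
    F.map φ ≫ p = p := by
  have := congrArg (fun f => F.map f ≫ p) hφ
  simpa [hp] using this.symm

lemma ModuleCat.projective_of_retract {R : Type u} [Ring R] {M N : ModuleCat.{u} R}
    [Module.Projective R N] {g : M ⟶ N} {p : N ⟶ M} (h : g ≫ p = 𝟙 M) : Module.Projective R M :=
  Module.Projective.of_split g.hom p.hom (congrArg ModuleCat.Hom.hom h)

namespace SingularityCategory

variable {R : Type u} [Ring R]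

/-- If the projective resolution of `M` vanishes in the singularity category and its cocycles with
values in projective modules extend, then `M` is projective. -/
lemma projective_of_isZero_trW_Q_obj (X : KMinusBounded R)
    [hLE : CochainComplex.IsStrictlyLE X.obj.as 0]
    (hX : ∀ (F : Proj R), ∀ i < 0, CochainComplex.ExtendsCocyclesAt X.obj.as F i)
    {M : ModuleCat.{u} R} (Q : ProjectiveResolution M)
    (e : moduleComplex X.obj.as ≅ Q.cochainComplex)
    (h : IsZero ((perfect R).trW.Q.obj X)) : Module.Projective R M := by
  -- The identity of `X` vanishes in the quotient, so it factors through a perfect complex, and then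
  -- through `Z'` in degrees `≥ 0`.
  obtain ⟨Z, hZ, a, b, hab⟩ := (perfect R).exists_factorization_of_trW_Q_map_eq_zero
    (f := 𝟙 X) (h.eq_of_src _ _)
  obtain ⟨Z', -, a', b', rfl, hGE⟩ := exists_factorization_perfect hX hZ a
  obtain ⟨α : X.obj.as ⟶ Z'.obj.as, hα⟩ :=
    (HomotopyCategory.quotient (Proj R) (.up ℤ)).map_surjective a'.hom
  obtain ⟨β : Z'.obj.as ⟶ X.obj.as, hβ⟩ :=
    (HomotopyCategory.quotient (Proj R) (.up ℤ)).map_surjective (b' ≫ b).hom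
  have hαβ : (HomotopyCategory.quotient (Proj R) (.up ℤ)).map (𝟙 X.obj.as) =
      (HomotopyCategory.quotient (Proj R) (.up ℤ)).map (α ≫ β) := by
    have h₁ := congrArg (fun f : X ⟶ X => f.hom) hab
    have h₂ : (HomotopyCategory.quotient (Proj R) (.up ℤ)).map (α ≫ β) =
        a'.hom ≫ (b' ≫ b).hom :=
      ((HomotopyCategory.quotient (Proj R) (.up ℤ)).map_comp α β).trans
        (congrArg₂ (· ≫ ·) hα hβ)
    refine ((HomotopyCategory.quotient (Proj R) (.up ℤ)).map_id _).trans (h₁.trans ?_)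
    exact (congrArg (fun f : X ⟶ X => f.hom) (Category.assoc a' b' b)).trans h₂.symm
  let H := HomotopyCategory.homotopyOfEq _ _ hαβ
  -- As `X` is zero in degree `1`, only one homotopy term survives in degree `0`: the identity is `α
  -- ≫ β` plus a map ending in `d`.
  have hH := H.comm 0
  rw [prevD_eq H.hom (show (ComplexShape.up ℤ).Rel (-1) 0 by simp),
    dNext_eq H.hom (show (ComplexShape.up ℤ).Rel 0 1 by simp),
    (CochainComplex.isZero_of_isStrictlyLE X.obj.as 0 1 (by simp)).eq_of_tgt
      (HomologicalComplex.d X.obj.as 0 1) 0, zero_comp, zero_add, add_comm] at hH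
  -- `Z'` is zero in degree `-1`, so `α ≫ β` kills boundaries in degree `0` and descends to a map `g
  -- : M ⟶ P⁰`, which is a section of the augmentation.
  have hd : HomologicalComplex.d X.obj.as (-1) 0 ≫ (α ≫ β).f 0 = 0 := by
    rw [← (α ≫ β).comm, HomologicalComplex.comp_f,
      (CochainComplex.isZero_of_isStrictlyGE Z'.obj.as 0 (-1) (by simp)).eq_of_tgt (α.f (-1)) 0,
      zero_comp, zero_comp]
  obtain ⟨p, hp, hdp, hdesc⟩ := Q.exists_augmentation e
  obtain ⟨g : M ⟶ (moduleComplex X.obj.as).X 0, hg⟩ := hdesc _ ((fgProj R).ι.map ((α ≫ β).f 0))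
    (((fgProj R).ι.map_comp _ _).symm.trans
      ((congrArg (fgProj R).ι.map hd).trans ((fgProj R).ι.map_zero _ _)))
  have hgp : g ≫ p = 𝟙 M := by
    refine (cancel_epi p).1 ((Category.assoc p g p).symm.trans ((congrArg (· ≫ p) hg).trans
      (Eq.trans ?_ (Category.comp_id p).symm)))
    exact (fgProj R).ι.map_comp_eq_of_id_eq_add hH hdp
  have : Module.Projective R ((moduleComplex X.obj.as).X 0) :=
    (HomologicalComplex.X X.obj.as 0).property.2
  exact ModuleCat.projective_of_retract hgp

end SingularityCategory

/-! ### From modules to presilting objects, and invariance under brutal truncation -/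

namespace SingularityCategory

open Abelian

variable {R : Type u} [Ring R]

lemma isStrictlyLE_of_moduleComplex (P : CochainComplex (Proj R) ℤ) (n : ℤ)
    [h : (moduleComplex P).IsStrictlyLE n] : P.IsStrictlyLE n := by
  rw [CochainComplex.isStrictlyLE_iff] at h ⊢
  exact fun i hi => (h i hi).of_full_of_faithful_of_isZero (fgProj R).ι _

/-- A finitely generated module whose self-extensions and extensions by the ring vanish yields a
presilting object. -/
lemma exists_isPresilting [IsNoetherianRing R] (M : ModuleCat.{u} R) [Module.Finite R M]
    (hM : ∀ n : ℕ, 1 ≤ n → Subsingleton (Ext.{u} M M n))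
    (hR : ∀ n : ℕ, 1 ≤ n → Subsingleton (Ext.{u} M (ModuleCat.of R R) n)) :
    ∃ X : Dsg R, IsPresilting X ∧ (IsZero X → Module.Projective R M) := by
  obtain ⟨Q, hQ⟩ := exists_fgProj_resolution M
  have hX (i : ℤ) : fgProj R (Q.cochainComplex.X i) := by
    by_cases hi : i ≤ 0
    · obtain ⟨k, rfl⟩ := Int.exists_eq_neg_ofNat hi
      exact (fgProj R).prop_of_iso (Q.cochainComplexXIso (-k) k).symm (hQ k)
    · exact (fgProj R).prop_of_isZero (Q.cochainComplex.isZero_of_isStrictlyLE 0 i (by lia))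
  let P : CochainComplex (Proj R) ℤ :=
    HomologicalComplex.liftObjectProperty (fgProj R) Q.cochainComplex hX
  let e : moduleComplex P ≅ Q.cochainComplex := Iso.refl _
  have : (moduleComplex P).IsStrictlyLE 0 :=
    inferInstanceAs (Q.cochainComplex.IsStrictlyLE 0)
  have := isStrictlyLE_of_moduleComplex P 0
  have : (moduleComplex P).IsGE 0 := CochainComplex.isGE_of_iso e.symm 0
  let X : KMinusBounded R := kMinusBoundedOf P 0 0
  have hE : ∀ (F : Proj R), ∀ i < 0, P.ExtendsCocyclesAt F i :=
    extendsCocyclesAt_of_subsingleton_ext Q e hR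
  refine ⟨(perfect R).trW.Q.obj X, ?_, projective_of_isZero_trW_Q_obj X (hLE := ‹_›) hE Q e⟩
  rw [isPresilting_trW_Q_obj_iff X (hLE := ‹_›) hE]
  intro n hn
  lift n to ℕ using hn.le
  rw [forall_shiftedHom_eq_zero_iff_subsingleton_ext X (hLE := ‹_›) Q e]
  exact hM n (by lia)

/-- The projection to a brutal truncation becomes an isomorphism in the singularity category. -/
lemma trW_of_brutalProjection {X Y : KMinusBounded R} (P : CochainComplex (Proj R) ℤ)
    {p : ℤ → Prop} [DecidablePred p] (hp : ∀ i, p (i + 1) → p i) (φ : X ⟶ Y)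
    (eX : X.obj ≅ (HomotopyCategory.quotient _ _).obj P)
    (eY : Y.obj ≅ (HomotopyCategory.quotient _ _).obj (P.brutal p))
    (hφ : φ.hom ≫ eY.hom = eX.hom ≫ (HomotopyCategory.quotient _ _).map (P.brutalProjection hp))
    (h : bounded (Proj R) ((HomotopyCategory.quotient _ _).obj (P.brutal (fun i => ¬ p i)))) :
    (perfect R).trW φ := by
  obtain ⟨Z, g, k, hT⟩ := distinguished_cocone_triangle φ
  rw [(perfect R).trW_iff]
  refine ⟨Z, g, k, hT, ?_⟩
  -- Rotating the triangle of the degreewise split sequence identifies the cone of the projection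
  -- with the complementary truncation shifted by `1`, which is bounded.
  let T := CochainComplex.trianglehOfDegreewiseSplit (P.brutalShortComplex p hp)
    (P.brutalSplitting hp)
  have hT' : T ∈ distTriang _ := (HomotopyCategory.distinguished_iff_iso_trianglehOfDegreewiseSplit
    T).2 ⟨_, _, ⟨Iso.refl _⟩⟩
  let e := isoTriangleOfIso₁₂ _ _ ((minusBounded R).ι.map_distinguished _ hT)
    (rot_of_distTriang _ hT') eX eY hφ
  exact ⟨_, (bounded (Proj R)).le_shift 1 _ h, ⟨Triangle.π₃.mapIso e⟩⟩

end SingularityCategory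

/-! ### From presilting objects to modules under finite injective dimension -/

open Abelian

/-- On a complex of projective objects which is exact below the injective dimension of `Y`, the
cocycles with values in `Y` extend in negative degrees. -/
lemma CochainComplex.extendsCocyclesAt_of_hasInjectiveDimensionLE {C : Type u} [Category.{v} C]
    [Abelian C] [HasExt.{v} C] (K : CochainComplex C ℤ) [∀ i, Projective (K.X i)] (d : ℕ)
    [K.IsGE d] (Y : C) [HasInjectiveDimensionLE Y d] {i : ℤ} (hi : i < 0) :
    K.ExtendsCocyclesAt Y i := by
  obtain ⟨k, rfl⟩ := Int.exists_eq_neg_ofNat hi.le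
  have : (K⟦(d : ℤ)⟧).IsGE 0 := K.isGE_shift d d 0 (by lia)
  have (j : ℤ) : Projective ((K⟦(d : ℤ)⟧).X j) := inferInstanceAs (Projective (K.X (j + d)))
  -- After the shift by `d`, the part in degrees `≤ 0` is a resolution, and degree `-k` of `K`
  -- becomes degree `-(k + d)`. The obstruction is an `Ext` of degree `k + d > d` into `Y`.
  refine ExtendsCocyclesAt.of_shift (d := d) (i := -(k + d : ℕ)) ?_ (by lia)
  have h₁ := (K⟦(d : ℤ)⟧).isIso_toExtendRestriction_f (-(k + d : ℕ) - 1) (by lia)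
  have h₂ := (K⟦(d : ℤ)⟧).isIso_toExtendRestriction_f (-(k + d : ℕ)) (by lia)
  have h₃ := (K⟦(d : ℤ)⟧).isIso_toExtendRestriction_f (-(k + d : ℕ) + 1) (by lia)
  rw [extendsCocyclesAt_iff_of_isIso (K⟦(d : ℤ)⟧).toExtendRestriction]
  let Q := ProjectiveResolution.ofCochainComplex (K⟦(d : ℤ)⟧)
  refine (Q.extendsCocyclesAt_iff_subsingleton_ext Y (k + d) (by lia)).2 ?_
  exact HasInjectiveDimensionLT.subsingleton Y (d + 1) (k + d) (by lia) _

namespace SingularityCategory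

variable {R : Type u} [Ring R]

section

variable (P : CochainComplex (Proj R) ℤ)

instance isStrictlyLE_brutal (n : ℤ) : (P.brutal (· ≤ n)).IsStrictlyLE n := by
  rw [CochainComplex.isStrictlyLE_iff]
  exact fun i hi => P.isZero_brutalX (p := (· ≤ n)) (by lia)

/-- The projection to the part in degrees `≤ n`. -/
noncomputable abbrev brutalProjectionLE (n : ℤ) : P ⟶ P.brutal (· ≤ n) :=
  P.brutalProjection (fun i hi => by lia)

lemma isIso_map_brutalProjectionLE_f {i n : ℤ} (hi : i ≤ n) :
    IsIso ((((fgProj R).ι.mapHomologicalComplex (.up ℤ)).map (brutalProjectionLE P n)).f i) := by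
  have := P.isIso_brutalProjection_f (p := (· ≤ n)) (fun i hi => by lia) hi
  exact inferInstanceAs (IsIso ((fgProj R).ι.map ((brutalProjectionLE P n).f i)))

/-- Exactness in degree `i < n` involves only degrees up to `i + 1 ≤ n`, where the truncation agrees
with `P`. -/
lemma isGE_moduleComplex_brutal (n a : ℤ) (h : n ≤ a) [(moduleComplex P).IsGE a] :
    (moduleComplex (P.brutal (· ≤ n))).IsGE n := by
  rw [CochainComplex.isGE_iff]
  intro i hi
  have h₁ := isIso_map_brutalProjectionLE_f P (i := i - 1) (n := n) (by lia)
  have h₂ := isIso_map_brutalProjectionLE_f P (i := i) (n := n) (by lia)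
  have h₃ := isIso_map_brutalProjectionLE_f P (i := i + 1) (n := n) (by lia)
  rw [← CochainComplex.exactAt_iff_of_isIso
    (((fgProj R).ι.mapHomologicalComplex (.up ℤ)).map (brutalProjectionLE P n))]
  exact (moduleComplex P).exactAt_of_isGE a i (by lia)

/-- In the singularity category, a complex is isomorphic to its brutal truncations. -/
noncomputable def trWQIsoBrutal (n a b b' : ℤ) [P.IsStrictlyLE b] [(moduleComplex P).IsGE a]
    [(moduleComplex (P.brutal (· ≤ n))).IsGE b'] :
    (perfect R).trW.Q.obj (kMinusBoundedOf P a b) ≅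
      (perfect R).trW.Q.obj (kMinusBoundedOf (P.brutal (· ≤ n)) b' n) :=
  Localization.isoOfHom (perfect R).trW.Q (perfect R).trW
    (ObjectProperty.homMk ((HomotopyCategory.quotient _ _).map (brutalProjectionLE P n)))
    (trW_of_brutalProjection P (p := (· ≤ n)) (fun i hi => by lia) _ (Iso.refl _) (Iso.refl _)
      ((Category.comp_id _).trans (Category.id_comp _).symm)
      ⟨⟨n, (CochainComplex.isStrictlyGE_iff _ _).2 fun i hi =>
        P.isZero_brutalX (p := fun i => ¬ i ≤ n) (by lia)⟩,
        b, P.isStrictlyLE_brutal_of_isStrictlyLE b⟩)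

end

/-- A projective resolution of a finitely generated projective module is perfect. -/
lemma perfect_of_projective (X : KMinusBounded R) [hLE : CochainComplex.IsStrictlyLE X.obj.as 0]
    {M : ModuleCat.{u} R} (Q : ProjectiveResolution M)
    (e : moduleComplex X.obj.as ≅ Q.cochainComplex) (hM : fgProj R M) : perfect R X := by
  let S : CochainComplex (Proj R) ℤ := (HomologicalComplex.single (Proj R) (.up ℤ) 0).obj ⟨M, hM⟩
  let s : moduleComplex S ≅ (CochainComplex.singleFunctor (ModuleCat.{u} R) 0).obj M :=
    (HomologicalComplex.singleMapHomologicalComplex (fgProj R).ι (.up ℤ) 0).app ⟨M, hM⟩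
  have : S.IsStrictlyLE 0 := (inferInstance :
    CochainComplex.IsStrictlyLE ((CochainComplex.singleFunctor (Proj R) 0).obj ⟨M, hM⟩) 0)
  have hGE : S.IsStrictlyGE 0 := (inferInstance :
    CochainComplex.IsStrictlyGE ((CochainComplex.singleFunctor (Proj R) 0).obj ⟨M, hM⟩) 0)
  have := isKProjective_moduleComplex S 0
  have := isKProjective_moduleComplex X.obj.as 0
  -- The resolution maps quasi-isomorphically to `M` in degree `0`. Both complexes are K-projective,
  -- so this is a homotopy equivalence, and it comes from `Proj R` by full faithfulness.
  let q : moduleComplex X.obj.as ⟶ moduleComplex S := e.hom ≫ Q.π' ≫ s.inv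
  have hq : QuasiIso q := inferInstance
  rw [CochainComplex.IsKProjective.quasiIso_iff] at hq
  have hq' := HomotopyCategory.quotient_inverts_homotopyEquivalences _ _ q hq
  let i : ((fgProj R).ι.mapHomotopyCategory (.up ℤ)).obj X.obj ≅
      ((fgProj R).ι.mapHomotopyCategory (.up ℤ)).obj ((HomotopyCategory.quotient _ _).obj S) :=
    @asIso _ _ _ _ ((HomotopyCategory.quotient _ _).map q) hq'
  exact ⟨(HomotopyCategory.quotient _ _).obj S, ⟨⟨0, hGE⟩, 0, ‹_›⟩,
    ⟨((fgProj R).ι.mapHomotopyCategory (.up ℤ)).preimageIso i⟩⟩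

/-- Every object of the singularity category is, up to a shift, given by a complex which is exact
in degrees `< d`. -/
lemma exists_iso_shift_trW_Q_obj (X : Dsg R) (d : ℤ) :
    ∃ (P : CochainComplex (Proj R) ℤ) (b : ℤ) (_ : P.IsStrictlyLE b)
      (_ : (moduleComplex P).IsGE d) (s : ℤ),
      Nonempty (X⟦s⟧ ≅ (perfect R).trW.Q.obj (kMinusBoundedOf P d b)) := by
  let X₀ := (perfect R).trW.Q.objPreimage X
  obtain ⟨a, ha⟩ := exists_isGE_moduleComplex X₀
  obtain ⟨b, hb⟩ := X₀.property.1
  let K : CochainComplex (Proj R) ℤ := X₀.obj.as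
  have : (K⟦a - d⟧).IsStrictlyLE (b - (a - d)) := K.isStrictlyLE_shift b (a - d) _ (by lia)
  have : ((moduleComplex K)⟦a - d⟧).IsGE d :=
    (moduleComplex K).isGE_shift a (a - d) d (by lia)
  let e : (moduleComplex K)⟦a - d⟧ ≅ moduleComplex (K⟦a - d⟧) :=
    (((fgProj R).ι.mapHomologicalComplex (.up ℤ)).commShiftIso (a - d)).symm.app K
  have := CochainComplex.isGE_of_iso e d
  -- Shifting by `a - d` moves the lower bound `a` of the cohomology to `d`.
  refine ⟨K⟦a - d⟧, b - (a - d), inferInstance, inferInstance, a - d, ⟨?_⟩⟩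
  exact (shiftFunctor _ (a - d)).mapIso ((perfect R).trW.Q.objObjPreimageIso X).symm ≪≫
    ((perfect R).trW.Q.commShiftIso (a - d)).symm.app X₀ ≪≫
    (perfect R).trW.Q.mapIso ((minusBounded R).fullyFaithfulι.preimageIso (shiftObjIso X₀ (a - d)))

/-- If the injective dimension of `R` is finite, then any presilting object of the singularity
category is given by a module without self-extensions and without extensions by the ring. -/
lemma exists_module_of_isPresilting (d : ℕ) [HasInjectiveDimensionLE (ModuleCat.of R R) d]
    (X : Dsg R) (hX : IsPresilting X) :
    ∃ M : ModuleCat.{u} R, Module.Finite R M ∧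
      (∀ n : ℕ, 1 ≤ n → Subsingleton (Ext.{u} M M n)) ∧
      (∀ n : ℕ, 1 ≤ n → Subsingleton (Ext.{u} M (ModuleCat.of R R) n)) ∧
      (Module.Projective R M → IsZero X) := by
  obtain ⟨P, b, _, _, s, ⟨i⟩⟩ := exists_iso_shift_trW_Q_obj X d
  -- The cut is at `0` although `P` is exact up to degree `d - 1`; these `d` extra exact degrees
  -- make `M` a `d`-th syzygy.
  let T : CochainComplex (Proj R) ℤ := P.brutal (· ≤ 0)
  have : T.IsStrictlyLE 0 := isStrictlyLE_brutal P 0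
  have : (moduleComplex T).IsGE 0 := isGE_moduleComplex_brutal P 0 d (by lia)
  let Y : KMinusBounded R := kMinusBoundedOf T 0 0
  let j : X⟦s⟧ ≅ (perfect R).trW.Q.obj Y := i ≪≫ trWQIsoBrutal P 0 d b 0
  let M : ModuleCat.{u} R :=
    cokernel (((moduleComplex T).restriction ComplexShape.embeddingDownNat).d 1 0)
  let Q : ProjectiveResolution M := ProjectiveResolution.ofCochainComplex (moduleComplex T)
  let e : moduleComplex T ≅ Q.cochainComplex :=
    @asIso _ _ _ _ (moduleComplex T).toExtendRestriction
      (moduleComplex T).isIso_toExtendRestriction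
  have hR : ∀ n : ℕ, 1 ≤ n → Subsingleton (Ext.{u} M (ModuleCat.of R R) n) := by
    intro n hn
    rw [← Q.extendsCocyclesAt_iff_subsingleton_ext _ n hn,
      ← CochainComplex.extendsCocyclesAt_iff_of_isIso e.hom]
    have h₁ := isIso_map_brutalProjectionLE_f P (i := -(n : ℤ) - 1) (n := 0) (by lia)
    have h₂ := isIso_map_brutalProjectionLE_f P (i := -(n : ℤ)) (n := 0) (by lia)
    have h₃ := isIso_map_brutalProjectionLE_f P (i := -(n : ℤ) + 1) (n := 0) (by lia)
    -- Near degree `-n` the truncation agrees with `P`, where the injective dimension bound applies.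
    rw [← CochainComplex.extendsCocyclesAt_iff_of_isIso
      (((fgProj R).ι.mapHomologicalComplex (.up ℤ)).map (brutalProjectionLE P 0))]
    exact (moduleComplex P).extendsCocyclesAt_of_hasInjectiveDimensionLE d _ (by lia)
  have hE := extendsCocyclesAt_of_subsingleton_ext Q e hR
  have hLE : CochainComplex.IsStrictlyLE Y.obj.as 0 := inferInstanceAs (T.IsStrictlyLE 0)
  have hM : Module.Finite R M := by
    obtain ⟨p, hp, -⟩ := Q.exists_augmentation e
    have : Module.Finite R ((moduleComplex T).X 0) := (T.X 0).property.1
    exact Module.Finite.of_surjective p.hom ((ModuleCat.epi_iff_surjective p).1 hp)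
  refine ⟨M, hM, fun n hn => ?_, hR, fun hp => ?_⟩
  · rw [← forall_shiftedHom_eq_zero_iff_subsingleton_ext Y Q e]
    exact (isPresilting_trW_Q_obj_iff Y hE).1 ((hX.shift s).of_iso j) n (by lia)
  -- If `M` is projective, its resolution is perfect, so `X⟦s⟧` is zero, and the shift functor
  -- reflects zero objects.
  · have := (perfect R).isZero_trW_Q_obj (perfect_of_projective Y Q e ⟨hM, hp⟩)
    exact (this.of_iso j).of_full_of_faithful_of_isZero (shiftFunctor _ s) _

end SingularityCategory

theorem proposition4p13 (Λ : Type u) [Ring Λ] (hΛ : IsArtinAlgebra Λ) :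
    (SingularPresiltingConjecture Λ → AuslanderReitenConjecture Λ) ∧
      (IsGorenstein Λ → AuslanderReitenConjecture Λ → SingularPresiltingConjecture Λ) := by
  constructor
  · intro hSPC M _ _ hM hp
    by_contra! h
    have h (n : ℕ) (hn : 1 ≤ n) := (SingularityCategory.subsingleton_ext_prod_iff (ModuleCat.of Λ M)
      (ModuleCat.of Λ M) (ModuleCat.of Λ Λ) n).1 (h n hn)
    have := hΛ.isNoetherianRing
    obtain ⟨X, hX, hX'⟩ := SingularityCategory.exists_isPresilting (ModuleCat.of Λ M)
      (fun n hn => (h n hn).1) (fun n hn => (h n hn).2)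
    exact hSPC ⟨X, hX, fun hX₀ => hp (hX' hX₀)⟩
  · rintro hG hARC ⟨X, hX, hX₀⟩
    obtain ⟨d, _, -⟩ := hG.exists_injectiveDimension_le
    obtain ⟨M, hM, h₁, h₂, hp⟩ := SingularityCategory.exists_module_of_isPresilting d X hX
    obtain ⟨n, hn, h⟩ := hARC M hM fun h => hX₀ (hp h)
    exact (not_nontrivial_iff_subsingleton.2 ((SingularityCategory.subsingleton_ext_prod_iff M M
      (ModuleCat.of Λ Λ) n).2 ⟨h₁ n hn, h₂ n hn⟩)) h
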